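/- Let $K$ be the field of fractions of a complete discrete valuation ring $\mathcal{O}_K$ with perfect residue field of characteristic $p>0$, and let $v_p$ be the $p$-adic valuation on $\mathbb{Z}$. Let $L/K$ be a finite separable totally ramified extension of degree $n$ and $M/L$ a finite separable totally ramified extension of degree $m$; put $\nu=v_p(n)$, $\mu=v_p(m)$. (Then $M/K$ is finite separable and totally ramified of degree $nm$, with $v_p(nm)=\nu+\mu$.) For any finite separable totally ramified extension $E/F$ of such fields, of degree $d$, with $\delta=v_p(d)$, choose uniformizers $\pi_F,\pi_E$ and let $$\pi_F=\sum_{h\ge0}a_h\,\pi_E^{h+d}$$ be the unique expansion with Teichmüller representatives $a_h\in\mathcal{O}_F$ of the residue field as coefficients. For $0\le j\le\delta$ set $\tilde\imath_j=\min\{h\ge0: v_p(h+d)\le j,\ a_h\ne0\}$ (with $\tilde\imath_j=\infty$ if there is no such $h$), and define the indices of inseparability $$i_j=\min\{\tilde\imath_{j_1}+(j_1-j)\,v_E(p): j\le j_1\le\delta\},$$ where $v_E$ is the normalized valuation of $E$ ($v_E(p)=\infty$ in characteristic $p$, and $0\cdot\infty=0$). They are finite and do not depend on the choice of $\pi_F,\pi_E$.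 For $x\ge0$ put $$\tilde\phi^j_{E/F}(x)=i_j+p^jx,\qquad \phi^j_{E/F}(x)=\min\{\tilde\phi^{j_0}_{E/F}(x):0\le j_0\le j\}.$$ For $0\le l\le\nu+\mu$ let $\Omega_l=\{(j,k):0\le j\le\nu,\ 0\le k\le\mu,\ j+k=l\}$ and, for $x\ge0$, let $$\lambda^l_{M/K}(x)=\min\{m\,\phi^j_{L/K}(\phi^k_{M/L}(x)/m):(j,k)\in\Omega_l\}.$$ For $0\le a\le l$ let $$S^a_l(x)=\{(j,k)\in\Omega_a:\ m\,\tilde\phi^j_{L/K}(\tilde\phi^k_{M/L}(x)/m)=\lambda^l_{M/K}(x)\}.$$ Let $0\le l\le\nu+\mu$ and let $x\ge0$ be real. Then, for any choices of the uniformizers used to compute the indices of inseparability of $L/K$, $M/L$ and $M/K$ (the three choices being independent of each other): (a) $\phi^l_{M/K}(x)\ge\lambda^l_{M/K}(x)$. (b) If there is $l_0$ with $0\le l_0\le l$ such that $S^{l_0}_l(x)$ has exactly one element, then $\phi^l_{M/K}(x)=\lambda^l_{M/K}(x)$. -/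

import Mathlib

namespace GenHH

open Finset

/-- `B/A` (rings of integers of an extension of degree `n`) is totally ramified: over every
maximal ideal of `A` (there is only one if `A` is local) lies a prime of `B` whose ramification
index is the full degree `n`. -/
def IsTotallyRamified (A B : Type*) [CommRing A] [CommRing B] [Algebra A B] (n : ℕ) : Prop :=
  ∀ q : Ideal A, q.IsMaximal →
    ∃ P : Ideal B, P.IsPrime ∧ P.LiesOver q ∧ P.ramificationIdx A = n

/-- The Teichmüller representatives in a complete discrete valuation ring with perfect residue
field of characteristic `p`: the elements that are `p ^ k`-th powers for every `k`.
See `mem_teichmullerReps_iff` for the comparison with Mathlib's Teichmüller map. -/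
def teichmullerReps (p : ℕ) (A : Type*) [CommRing A] : Set A :=
  {a | ∀ k : ℕ, ∃ b : A, b ^ p ^ k = a}

/-- `teichmullerReps p A` is the image of the Teichmüller map. -/
theorem mem_teichmullerReps_iff (p : ℕ) [Fact p.Prime] (A : Type*) [CommRing A]
    [IsLocalRing A] [IsAdicComplete (IsLocalRing.maximalIdeal A) A]
    [CharP (A ⧸ IsLocalRing.maximalIdeal A) p] [PerfectRing (A ⧸ IsLocalRing.maximalIdeal A) p]
    (a : A) : a ∈ teichmullerReps p A ↔
      a ∈ Set.range (Perfection.teichmuller p (IsLocalRing.maximalIdeal A)) := by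
  constructor
  · intro h
    choose b hb using h
    set I := IsLocalRing.maximalIdeal A
    have key : ∀ k, (Ideal.Quotient.mk I (b (k + 1))) ^ p = Ideal.Quotient.mk I (b k) := by
      intro k
      apply (bijective_iterateFrobenius (A ⧸ I) p k).injective
      rw [iterateFrobenius_def, iterateFrobenius_def, ← pow_mul, ← pow_succ', ← map_pow, ← map_pow,
        hb, hb]
    refine ⟨⟨fun k => Ideal.Quotient.mk I (b k), key⟩, ?_⟩
    exact Perfection.teichmuller_spec fun k => ⟨b k, rfl, by rw [hb k]⟩
  · rintro ⟨x, rfl⟩ k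
    refine ⟨Perfection.teichmuller p (IsLocalRing.maximalIdeal A)
      ((iterateFrobeniusEquiv (Perfection (A ⧸ IsLocalRing.maximalIdeal A) p) p k).symm x), ?_⟩
    rw [← map_pow]
    congr 1
    exact (iterateFrobeniusEquiv (Perfection (A ⧸ IsLocalRing.maximalIdeal A) p) p
      k).apply_symm_apply x

section Indices

variable {A B : Type*} [CommRing A] [CommRing B] [Algebra A B]

/-- `πK = ∑_{h ≥ 0} a_h πL ^ (h + n)` in the `πL`-adic topology of `B`, with Teichmüller
representatives `a_h ∈ A` as coefficients. -/
def IsExpansion (p n : ℕ) (πK : A) (πL : B) (a : ℕ → A) : Prop :=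
  (∀ h, a h ∈ teichmullerReps p A) ∧
    ∀ N : ℕ, πL ^ (n + N) ∣
      algebraMap A B πK - ∑ h ∈ range N, algebraMap A B (a h) * πL ^ (h + n)

open Classical in
/-- The coefficients `a_h` of the expansion of `πK` in powers of `πL`. -/
noncomputable def coeffs (p n : ℕ) (πK : A) (πL : B) : ℕ → A :=
  if h : ∃ a, IsExpansion p n πK πL a then h.choose else 0

/-- `ĩ_j = min {h ≥ 0 : v_p (h + n) ≤ j, a_h ≠ 0}`, which is `∞` if there is no such `h`. -/
noncomputable def preIndex (p n : ℕ) (πK : A) (πL : B) (j : ℕ) : ℕ∞ :=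
  ⨅ h ∈ {h : ℕ | padicValNat p (h + n) ≤ j ∧ coeffs p n πK πL h ≠ 0}, (h : ℕ∞)

/-- The index of inseparability
`i_j = min {ĩ_{j₁} + (j₁ - j) v_L(p) : j ≤ j₁ ≤ ν}`, `ν = v_p (n)`, for `j ≤ ν`. Here `v_L(p)` is
the exponent of `πL` in `p`, which is `∞` in characteristic `p`. -/
noncomputable def index (p n : ℕ) (πK : A) (πL : B) (j : ℕ) : ℕ∞ :=
  (Icc j (padicValNat p n)).inf fun j₁ =>
    preIndex p n πK πL j₁ + ((j₁ - j : ℕ) : ℕ∞) * emultiplicity πL (p : B)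

/-- `φ̃^j (x) = i_j + p ^ j x`. (The index `i_j` is finite for a separable extension.) -/
noncomputable def phiTilde (p n : ℕ) (πK : A) (πL : B) (j : ℕ) (x : ℝ) : ℝ :=
  ((index p n πK πL j).toNat : ℝ) + (p : ℝ) ^ j * x

/-- The generalized Hasse-Herbrand function `φ^j (x) = min {φ̃^{j₀} (x) : 0 ≤ j₀ ≤ j}`. -/
noncomputable def phi (p n : ℕ) (πK : A) (πL : B) (j : ℕ) (x : ℝ) : ℝ :=
  (range (j + 1)).inf' nonempty_range_add_one fun j₀ => phiTilde p n πK πL j₀ x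

end Indices

/-- `Ω_l = {(j, k) : 0 ≤ j ≤ ν, 0 ≤ k ≤ μ, j + k = l}`. -/
def Omega (ν μ l : ℕ) : Finset (ℕ × ℕ) :=
  (range (ν + 1) ×ˢ range (μ + 1)).filter fun jk => jk.1 + jk.2 = l

theorem Omega_nonempty {ν μ l : ℕ} (hl : l ≤ ν + μ) : (Omega ν μ l).Nonempty :=
  ⟨(min l ν, l - min l ν), by simp only [Omega, mem_filter, mem_product, mem_range]; omega⟩

section Tower

variable {A B C : Type*} [CommRing A] [CommRing B] [CommRing C] [Algebra A B] [Algebra B C]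

/-- `λ^l (x) = min {m φ_{L/K}^j (φ_{M/L}^k (x) / m) : (j, k) ∈ Ω_l}`, where `n = [L : K]`,
`m = [M : L]`; `πK, πL` are the uniformizers used for `L/K` and `πL', πM` those for `M/L`. -/
noncomputable def lam (p n m : ℕ) (πK : A) (πL πL' : B) (πM : C) (l : ℕ)
    (hl : l ≤ padicValNat p n + padicValNat p m) (x : ℝ) : ℝ :=
  (Omega (padicValNat p n) (padicValNat p m) l).inf' (Omega_nonempty hl) fun jk =>
    m * phi p n πK πL jk.1 (phi p m πL' πM jk.2 x / m)

open Classical in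
/-- `S_l^a (x) = {(j, k) ∈ Ω_a : m φ̃_{L/K}^j (φ̃_{M/L}^k (x) / m) = λ^l (x)}`. -/
noncomputable def minPairs (p n m : ℕ) (πK : A) (πL πL' : B) (πM : C) (l : ℕ)
    (hl : l ≤ padicValNat p n + padicValNat p m) (a : ℕ) (x : ℝ) : Finset (ℕ × ℕ) :=
  (Omega (padicValNat p n) (padicValNat p m) a).filter fun jk =>
    m * phiTilde p n πK πL jk.1 (phiTilde p m πL' πM jk.2 x / m)
      = lam p n m πK πL πL' πM l hl x

end Tower

end GenHH

/-! The indices of inseparability are read off from a perturbed uniformizer. If `H` is a polynomial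
over `A` with `H(π) ∈ A`, nonunit coefficients below degree `n` and a unit in degree `n`, expand
`H(π(1 + u))` in powers of `u`. Then `n + i_j` is the least valuation of the coefficients of `u ^
k`, `1 ≤ k ≤ p ^ j` (`TotRam.le_idx_iff`). For the truncated expansion of the uniformizer this
follows from the `p`-adic valuations of binomial coefficients, and where the sequence `i_j` drops,
the coefficient of `u ^ (p ^ j)` attains the minimum (`TotRam.exists_good_polynomial`). All other
`H` follow because they differ only by multiples of the minimal polynomial and a change of variable
(`TotRam.dvd_coeff_shift`); so the choice of uniformizers is immaterial.

In a tower, take such polynomials `F` for `L/K` and `G` for `M/L`, both over `A`. Then `F ∘ G` is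
admissible for `M/K`. Writing `G(π_M(1 + u)) = π_L(1 + w(u))`, its expansion is `∑ d_k w ^ k` up to
the constant term, where the `d_k` carry the indices of `L/K` and the coefficients of `w` those of
`M/L` (`TotRam.exists_composition`).

Give `π_M` weight `1` and `u` weight `x`. In degrees up to `p ^ b`, `w` has weight at least
`φ_{M/L}^b(x)`. Raising to a `p`-th power either multiplies the weight by `p` and the degree by `p`,
or gains a factor `p`. Hence the sum has weight at least `nm + λ^l(x)` in degrees up to `p ^ l`
(`weightGE_composition`), which is (a).

For (b), a unique minimal pair can be moved to a level where, in addition, both index sequences drop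
(`exists_strict_pair`). With a suitable weight of `u` (`exists_weight`), a single term dominates the
coefficient of `u ^ (p ^ (j + k))`, whose valuation is then exactly `nm + m i_j + p ^ j i'_k`
(`not_pow_dvd_coeff_composition`). This bounds the index of `M/K` at `j + k` from above and gives
the reverse inequality. -/

namespace GenHH

open Finset Polynomial

/-! ### Totally ramified extensions of discrete valuation rings -/

section Basics

variable {A B C : Type*} [CommRing A] [IsDomain A] [IsDiscreteValuationRing A]
  [CommRing B] [IsDomain B] [IsDiscreteValuationRing B]
  [CommRing C] [IsDomain C] [IsDiscreteValuationRing C]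
  [Algebra A B] [Algebra B C] [Algebra A C] [IsScalarTower A B C]

theorem dvd_iff_not_isUnit {π : A} (hπ : Irreducible π) (x : A) : π ∣ x ↔ ¬ IsUnit x := by
  rw [← mem_nonunits_iff, ← IsLocalRing.mem_maximalIdeal, hπ.maximalIdeal_eq,
    Ideal.mem_span_singleton]

theorem eq_zero_of_forall_pow_dvd {π : A} (hπ : Irreducible π) {x : A} (h : ∀ k, π ^ k ∣ x) :
    x = 0 := by
  by_contra hx
  obtain ⟨k, u, rfl⟩ := IsDiscreteValuationRing.eq_unit_mul_pow_irreducible hx hπ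
  have h1 := h (k + 1)
  rw [Units.dvd_mul_left, pow_dvd_pow_iff hπ.ne_zero hπ.not_isUnit] at h1
  omega

/-- A totally ramified extension of degree `n` of discrete valuation rings, finite and with
separable minimal polynomials. -/
structure TotRam (A B : Type*) [CommRing A] [IsDomain A] [IsDiscreteValuationRing A]
    [CommRing B] [IsDomain B] [IsDiscreteValuationRing B] [Algebra A B] (n : ℕ) : Prop where
  pos : 0 < n
  assoc : ∀ {a : A} {b : B}, Irreducible a → Irreducible b → Associated (algebraMap A B a) (b ^ n)
  residue : ∀ b : B, ∃ a : A, ¬ IsUnit (b - algebraMap A B a)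
  finite : Module.Finite A B
  sep : ∀ b : B, aeval b (derivative (minpoly A b)) ≠ 0

namespace TotRam

variable {n m : ℕ}

theorem trans (h1 : TotRam A B n) (h2 : TotRam B C m)
    (hsep : ∀ c : C, aeval c (derivative (minpoly A c)) ≠ 0) : TotRam A C (n * m) where
  pos := Nat.mul_pos h1.pos h2.pos
  assoc := by
    intro a c ha hc
    obtain ⟨b, hb⟩ := IsDiscreteValuationRing.exists_irreducible B
    have := (h1.assoc ha hb).map (algebraMap B C)
    rw [← IsScalarTower.algebraMap_apply, map_pow] at this
    refine this.trans ?_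
    rw [mul_comm, pow_mul]
    exact (h2.assoc hb hc).pow_pow
  residue := by
    intro c
    obtain ⟨π, hπ⟩ := IsDiscreteValuationRing.exists_irreducible C
    obtain ⟨ϖ, hϖ⟩ := IsDiscreteValuationRing.exists_irreducible B
    obtain ⟨b, hb⟩ := h2.residue c
    obtain ⟨a, ha⟩ := h1.residue b
    refine ⟨a, ?_⟩
    rw [← dvd_iff_not_isUnit hπ] at hb ⊢
    rw [← dvd_iff_not_isUnit hϖ] at ha
    have h3 : π ∣ algebraMap B C ϖ :=
      (dvd_pow_self π h2.pos.ne').trans (h2.assoc hϖ hπ).symm.dvd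
    have h4 := h3.trans (map_dvd (algebraMap B C) ha)
    have := dvd_add hb h4
    rwa [map_sub, ← IsScalarTower.algebraMap_apply, sub_add_sub_cancel] at this
  finite := by
    have := h1.finite
    have := h2.finite
    exact Module.Finite.trans B C
  sep := hsep

theorem dvd_algebraMap (h : TotRam A B n) {π : B} (hπ : Irreducible π) {a : A} (ha : ¬ IsUnit a) :
    π ^ n ∣ algebraMap A B a := by
  obtain ⟨ϖ, hϖ⟩ := IsDiscreteValuationRing.exists_irreducible A
  exact (h.assoc hϖ hπ).symm.dvd.trans (map_dvd _ ((dvd_iff_not_isUnit hϖ a).2 ha))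

theorem isUnit_of_not_dvd (h : TotRam A B n) {π : B} (hπ : Irreducible π) {a : A}
    (ha : ¬ π ∣ algebraMap A B a) : IsUnit a := by
  by_contra h1
  exact ha ((dvd_pow_self π h.pos.ne').trans (h.dvd_algebraMap hπ h1))

theorem isUnit_algebraMap_iff (h : TotRam A B n) {a : A} :
    IsUnit (algebraMap A B a) ↔ IsUnit a := by
  obtain ⟨π, hπ⟩ := IsDiscreteValuationRing.exists_irreducible B
  refine ⟨fun h1 => h.isUnit_of_not_dvd hπ ?_, fun h1 => h1.map _⟩
  rwa [dvd_iff_not_isUnit hπ, not_not]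

theorem injective (h : TotRam A B n) : Function.Injective (algebraMap A B) := by
  rw [injective_iff_map_eq_zero]
  intro a ha
  by_contra h0
  obtain ⟨ϖ, hϖ⟩ := IsDiscreteValuationRing.exists_irreducible A
  obtain ⟨π, hπ⟩ := IsDiscreteValuationRing.exists_irreducible B
  obtain ⟨k, u, rfl⟩ := IsDiscreteValuationRing.eq_unit_mul_pow_irreducible h0 hϖ
  rw [map_mul, map_pow, mul_eq_zero, pow_eq_zero_iff'] at ha
  rcases ha with ha | ha
  · exact (u.isUnit.map (algebraMap A B)).ne_zero ha
  · have := h.assoc hϖ hπ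
    rw [ha.1] at this
    exact pow_ne_zero n hπ.ne_zero ((associated_zero_iff_eq_zero _).1 this.symm)

theorem exists_aeval_sub_dvd (h : TotRam A B n) {π : B} (hπ : Irreducible π) (b : B) (k : ℕ) :
    ∃ P : A[X], π ^ k ∣ b - aeval π P := by
  induction k with
  | zero => exact ⟨0, by simp⟩
  | succ k ih =>
    obtain ⟨P, c, hc⟩ := ih
    obtain ⟨a, ha⟩ := h.residue c
    obtain ⟨d, hd⟩ := (dvd_iff_not_isUnit hπ _).2 ha
    refine ⟨P + Polynomial.C a * X ^ k, d, ?_⟩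
    simp only [map_add, map_mul, aeval_C, map_pow, aeval_X]
    linear_combination hc + π ^ k * hd

/-- This is `B = A[π]`: approximation modulo `π ^ n`, which is a uniformizer of `A` up to a unit,
shows that `A[π]` fills `B` modulo the maximal ideal of `A`, and Nakayama finishes. -/
theorem exists_aeval_eq (h : TotRam A B n) {π : B} (hπ : Irreducible π) (b : B) :
    ∃ P : A[X], aeval π P = b := by
  have := h.finite
  obtain ⟨ϖ, hϖ⟩ := IsDiscreteValuationRing.exists_irreducible A
  suffices (⊤ : Submodule A B) ≤ LinearMap.range (aeval (R := A) π).toLinearMap by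
    obtain ⟨P, hP⟩ := this (Submodule.mem_top (x := b))
    exact ⟨P, hP⟩
  refine Submodule.le_of_le_smul_of_le_jacobson_bot (I := IsLocalRing.maximalIdeal A)
    Module.Finite.fg_top (IsLocalRing.maximalIdeal_le_jacobson _) ?_
  intro x _
  obtain ⟨P, hP⟩ := h.exists_aeval_sub_dvd hπ x n
  obtain ⟨c, hc⟩ := (h.assoc hϖ hπ).dvd.trans hP
  rw [show x = aeval π P + ϖ • c by rw [Algebra.smul_def, ← hc]; ring]
  refine Submodule.add_mem_sup ⟨P, rfl⟩ (Submodule.smul_mem_smul ?_ Submodule.mem_top)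
  rw [hϖ.maximalIdeal_eq]
  exact Ideal.mem_span_singleton_self ϖ

/-- At the first unit coefficient, in degree `i < n`, the term has valuation exactly `i`; earlier
terms have valuation at least `n` and later ones more than `i`, so nothing can cancel it. -/
theorem not_isUnit_coeff (h : TotRam A B n) {π : B} (hπ : Irreducible π) {P : A[X]}
    (hP : π ^ n ∣ aeval π P) {i : ℕ} (hi : i < n) : ¬ IsUnit (P.coeff i) := by
  induction i using Nat.strong_induction_on with
  | _ i ih =>
    intro hu
    have hu' := (h.isUnit_algebraMap_iff).2 hu
    have key : π ^ (i + 1) ∣ algebraMap A B (P.coeff i) * π ^ i := by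
      rw [aeval_eq_sum_range' (n := P.natDegree + i + 1) (by omega)] at hP
      rw [← Finset.add_sum_erase _ _ (show i ∈ range (P.natDegree + i + 1) by
        simp only [mem_range]; omega), Algebra.smul_def] at hP
      refine (dvd_add_left ?_).1 ((pow_dvd_pow π (show i + 1 ≤ n from hi)).trans hP)
      refine dvd_sum fun j hj => ?_
      rw [Algebra.smul_def]
      rcases lt_trichotomy j i with hji | hji | hji
      · exact (((pow_dvd_pow π (show i + 1 ≤ n from hi)).trans
          (h.dvd_algebraMap hπ (ih j hji (by omega))))).mul_right _
      · simp [hji] at hj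
      · exact (pow_dvd_pow π (show i + 1 ≤ j from hji)).mul_left _
    rw [hu'.dvd_mul_left, pow_dvd_pow_iff hπ.ne_zero hπ.not_isUnit] at key
    omega

theorem isIntegral (h : TotRam A B n) (b : B) : IsIntegral A b :=
  have := h.finite
  Algebra.IsIntegral.isIntegral b

/-- A polynomial vanishing at a uniformizer, with a unit as `n`-th coefficient, is a multiple of
the minimal polynomial by a polynomial that is a unit at the uniformizer. -/
theorem exists_eq_mul_minpoly (h : TotRam A B n) {π : B} (hπ : Irreducible π) {P : A[X]}
    (hP : aeval π P = 0) (hu : IsUnit (P.coeff n)) :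
    ∃ Q : A[X], P = Q * minpoly A π ∧ IsUnit (aeval π Q) := by
  have : FaithfulSMul A B := (faithfulSMul_iff_algebraMap_injective A B).2 h.injective
  obtain ⟨Q, hQ⟩ := minpoly.isIntegrallyClosed_dvd (h.isIntegral π) hP
  rw [mul_comm] at hQ
  refine ⟨Q, hQ, ?_⟩
  -- In degree `n` of the product, every term except the one with `Q.coeff 0` contains a coefficient
  -- of the minimal polynomial below degree `n`, which is a nonunit.
  have h0 : IsUnit (Q.coeff 0) := by
    by_contra h0
    rw [hQ, coeff_mul] at hu
    revert hu
    change ¬ IsUnit _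
    rw [← mem_nonunits_iff, ← IsLocalRing.mem_maximalIdeal]
    refine Ideal.sum_mem _ fun ij hij => ?_
    rw [HasAntidiagonal.mem_antidiagonal] at hij
    rcases Nat.eq_zero_or_pos ij.1 with h1 | h1
    · rw [h1]
      exact Ideal.mul_mem_right _ _ ((IsLocalRing.mem_maximalIdeal _).2 h0)
    · refine Ideal.mul_mem_left _ _ ((IsLocalRing.mem_maximalIdeal _).2 ?_)
      exact h.not_isUnit_coeff hπ (by rw [minpoly.aeval]; exact dvd_zero _) (by omega)
  rw [← not_not (a := IsUnit _), ← dvd_iff_not_isUnit hπ]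
  intro h1
  rw [← Polynomial.divX_mul_X_add Q, map_add, map_mul, aeval_X, aeval_C] at h1
  have := (dvd_add_right (dvd_mul_left π _)).1 h1
  rw [dvd_iff_not_isUnit hπ, h.isUnit_algebraMap_iff] at this
  exact this h0

end TotRam

end Basics

/-! ### Expansion of a polynomial at a perturbed point `π(1 + u)` -/

section Shift

variable {R : Type*} [CommRing R]

/-- `P (π (1 + u))` as a polynomial in `u`. -/
noncomputable def shift (π : R) (P : R[X]) : R[X] := P.comp (C π * (1 + X))

theorem shift_add (π : R) (P Q : R[X]) : shift π (P + Q) = shift π P + shift π Q := add_comp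

theorem shift_sub (π : R) (P Q : R[X]) : shift π (P - Q) = shift π P - shift π Q := sub_comp

theorem shift_mul (π : R) (P Q : R[X]) : shift π (P * Q) = shift π P * shift π Q := mul_comp _ _ _

@[simp] theorem shift_C (π r : R) : shift π (C r) = C r := C_comp

theorem shift_sum {ι : Type*} (π : R) (s : Finset ι) (f : ι → R[X]) :
    shift π (∑ i ∈ s, f i) = ∑ i ∈ s, shift π (f i) := by
  simp [shift]

theorem coeff_shift_zero (π : R) (P : R[X]) : (shift π P).coeff 0 = P.eval π := by
  rw [coeff_zero_eq_eval_zero, shift, eval_comp]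
  simp

theorem coeff_shift_monomial (π r : R) (i k : ℕ) :
    (shift π (C r * X ^ i)).coeff k = r * π ^ i * (i.choose k : R) := by
  rw [shift, mul_comp, C_comp, pow_comp, X_comp, mul_pow, ← C_pow, ← mul_assoc, ← C_mul,
    coeff_C_mul,
    coeff_one_add_X_pow]

theorem coeff_shift_one (π : R) (P : R[X]) :
    (shift π P).coeff 1 = π * (derivative P).eval π := by
  have h : (derivative (shift π P)).coeff 0 = π * (derivative P).eval π := by
    rw [shift, derivative_comp, coeff_zero_eq_eval_zero]
    simp
  rw [← h, coeff_derivative]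
  simp

/-- `P (π' (1 + w)) = Q` if `π' (1 + w) = G (π (1 + u))` and `Q = (P ∘ G) (π (1 + u))`. -/
theorem shift_comp {π π' : R} {w G : R[X]} (hw : shift π G = C π' * (1 + w)) (P : R[X]) :
    shift π (P.comp G) = (shift π' P).comp w := by
  rw [shift, comp_assoc, show G.comp (C π * (1 + X)) = shift π G from rfl, hw, shift, comp_assoc]
  simp

theorem coeff_pow_eq_zero {w : R[X]} (hw : w.coeff 0 = 0) {r k : ℕ} (h : r < k) :
    (w ^ k).coeff r = 0 :=
  X_pow_dvd_iff.1 (pow_dvd_pow_of_dvd (X_dvd_iff.2 hw) k) r h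

theorem comp_sub_C_eq_sum (P w : R[X]) {N : ℕ} (hN : P.natDegree < N) :
    P.comp w - C (P.coeff 0) = ∑ k ∈ Ico 1 N, C (P.coeff k) * w ^ k := by
  rw [comp, eval₂_eq_sum_range' C hN, range_eq_Ico, Finset.sum_eq_sum_Ico_succ_bot (by omega)]
  simp

/-- Since `w` has no constant term, `w ^ i` starts in degree `i`, so only the coefficients of `P` in
degrees `1` to `N` enter. -/
theorem dvd_coeff_comp {w P : R[X]} (hw : w.coeff 0 = 0) {d : R} {N : ℕ}
    (h : ∀ k, 1 ≤ k → k ≤ N → d ∣ P.coeff k) {k : ℕ} (hk : k ≤ N) :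
    d ∣ (P.comp w - C (P.coeff 0)).coeff k := by
  rw [comp_sub_C_eq_sum P w (Nat.lt_succ_self _), finsetSum_coeff]
  refine dvd_sum fun i hi => ?_
  rw [coeff_C_mul]
  rw [mem_Ico] at hi
  rcases le_or_gt i N with h1 | h1
  · exact (h i hi.1 h1).mul_right _
  · rw [coeff_pow_eq_zero hw (by omega), mul_zero]
    exact dvd_zero _

theorem dvd_coeff_mul {P Q : R[X]} {d : R} {N : ℕ} (h : ∀ k ≤ N, d ∣ Q.coeff k) {k : ℕ}
    (hk : k ≤ N) : d ∣ (P * Q).coeff k := by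
  rw [coeff_mul]
  refine dvd_sum fun ij hij => (h _ ?_).mul_left _
  rw [HasAntidiagonal.mem_antidiagonal] at hij
  omega

/-- A factor with unit constant term is invertible as a power series, so it can be cancelled degree
by degree. -/
theorem dvd_coeff_of_dvd_coeff_mul {P Q : R[X]} {d : R} {N : ℕ} (hP : IsUnit (P.coeff 0))
    (h : ∀ k ≤ N, d ∣ (P * Q).coeff k) {k : ℕ} (hk : k ≤ N) : d ∣ Q.coeff k := by
  induction k using Nat.strong_induction_on with
  | _ k ih =>
    have h1 := h k hk
    rw [coeff_mul, ← Finset.add_sum_erase _ _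
      (show (0, k) ∈ HasAntidiagonal.antidiagonal k by simp)] at h1
    refine hP.dvd_mul_left.1 ((dvd_add_left (dvd_sum fun ij hij => ?_)).1 h1)
    rw [mem_erase, HasAntidiagonal.mem_antidiagonal] at hij
    refine (ih _ ?_ ?_).mul_left _
    · have : ij.1 ≠ 0 := fun h0 => hij.1 (Prod.ext h0 (by simp; omega))
      omega
    · omega

end Shift

/-! ### Independence of the uniformizer and of the polynomial -/

section Comparison

variable {A B : Type*} [CommRing A] [IsDomain A] [IsDiscreteValuationRing A]
  [CommRing B] [IsDomain B] [IsDiscreteValuationRing B] [Algebra A B] {n : ℕ}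

/-- Over the residue field, `F` and `G` become `X ^ n * F'` and `X ^ m * G'` with `F'`, `G'` nonzero
at `0`, so the composite is `X ^ (n * m)` times a polynomial nonzero at `0`. -/
theorem isUnit_coeff_comp {A : Type*} [CommRing A] [IsLocalRing A] {F G : A[X]} {n m : ℕ}
    (hm : 0 < m) (hF : ∀ i < n, ¬ IsUnit (F.coeff i)) (hFn : IsUnit (F.coeff n))
    (hG : ∀ i < m, ¬ IsUnit (G.coeff i)) (hGm : IsUnit (G.coeff m)) :
    IsUnit ((F.comp G).coeff (n * m)) := by
  have key : ∀ a : A, IsUnit a ↔ IsLocalRing.residue A a ≠ 0 := fun a => by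
    rw [Ne, IsLocalRing.residue_eq_zero_iff, IsLocalRing.mem_maximalIdeal, mem_nonunits_iff,
      not_not]
  have cX : ∀ (P : (IsLocalRing.ResidueField A)[X]) (k : ℕ), (X ^ k * P).coeff k = P.coeff 0 :=
    fun P k => by simpa using coeff_X_pow_mul P k 0
  rw [key] at hFn hGm ⊢
  simp only [key, not_not] at hF hG
  obtain ⟨F', hF'⟩ : X ^ n ∣ F.map (IsLocalRing.residue A) :=
    X_pow_dvd_iff.2 fun i hi => by rw [coeff_map]; exact hF i hi
  obtain ⟨G', hG'⟩ : X ^ m ∣ G.map (IsLocalRing.residue A) :=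
    X_pow_dvd_iff.2 fun i hi => by rw [coeff_map]; exact hG i hi
  rw [← coeff_map, hF', cX] at hFn
  rw [← coeff_map, hG', cX] at hGm
  rw [← coeff_map, Polynomial.map_comp, hF', hG', mul_comp, pow_comp, X_comp, mul_pow, ← pow_mul,
    mul_comm m n, mul_assoc, cX, mul_coeff_zero,
    coeff_zero_eq_eval_zero (G' ^ n), eval_pow, ← coeff_zero_eq_eval_zero,
    coeff_zero_eq_eval_zero (F'.comp _), eval_comp, eval_mul, eval_pow, eval_X,
    zero_pow hm.ne', zero_mul, ← coeff_zero_eq_eval_zero]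
  exact mul_ne_zero (pow_ne_zero _ hGm) hFn

/-- The change of variable between uniformizers: with `π₂ = π₁ g(π₁)`, replacing `π₁` by `π₁(1 + u)`
replaces `π₂` by `π₂(1 + w(u))`. -/
theorem TotRam.exists_aeval_X_mul_eq (h : TotRam A B n) {π₁ π₂ : B} (h₁ : Irreducible π₁)
    (h₂ : Irreducible π₂) : ∃ (g : A[X]) (w : B[X]), aeval π₁ (X * g) = π₂ ∧ IsUnit (g.coeff 0) ∧
      w.coeff 0 = 0 ∧ shift π₁ ((X * g).map (algebraMap A B)) = C π₂ * (1 + w) := by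
  obtain ⟨ε, hε⟩ := IsDiscreteValuationRing.associated_of_irreducible B h₁ h₂
  obtain ⟨g, hg⟩ := h.exists_aeval_eq h₁ (ε : B)
  have h0 : aeval π₁ (X * g) = π₂ := by rw [map_mul, aeval_X, hg, hε]
  have hw : shift π₁ ((X * g).map (algebraMap A B)) = C π₂ *
      (1 + (C ((ε⁻¹ : Bˣ) : B) * (1 + X) * shift π₁ (g.map (algebraMap A B)) - 1)) := by
    rw [add_sub_cancel, ← hε, Polynomial.map_mul, shift_mul, map_X, shift, X_comp]
    have : C (ε : B) * C ((ε⁻¹ : Bˣ) : B) = 1 := by rw [← C_mul, ε.mul_inv, C_1]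
    rw [C_mul]
    linear_combination (-(C π₁ * (1 + X) * shift π₁ (g.map (algebraMap A B)))) * this
  refine ⟨g, _, h0, ?_, ?_, hw⟩
  · rw [← not_not (a := IsUnit _)]
    intro h1
    have h2 := (dvd_pow_self π₁ h.pos.ne').trans (h.dvd_algebraMap h₁ h1)
    rw [← Polynomial.divX_mul_X_add g, map_add, map_mul, aeval_X, aeval_C] at hg
    have h3 : π₁ ∣ (ε : B) := hg ▸ dvd_add (dvd_mul_left _ _) h2
    exact (dvd_iff_not_isUnit h₁ _).1 h3 ε.isUnit
  · have : (shift π₁ (g.map (algebraMap A B))).coeff 0 = ε := by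
      rw [coeff_shift_zero, eval_map_algebraMap, hg]
    rw [coeff_sub, mul_coeff_zero, this, mul_coeff_zero]
    simp

/-- Divisibility of the coefficients of `P (π (1 + u))` by a power of a uniformizer
does not depend on the choice of the uniformizer `π` nor on the polynomial `P`. -/
theorem TotRam.dvd_coeff_shift (h : TotRam A B n) {π₁ π₂ : B} (h₁ : Irreducible π₁)
    (h₂ : Irreducible π₂) {H₁ H₂ : A[X]} {α₁ α₂ : A} (hH₁ : aeval π₁ H₁ = algebraMap A B α₁)
    (hH₂ : aeval π₂ H₂ = algebraMap A B α₂) (hu₁ : IsUnit (H₁.coeff n)) (hu₂ : IsUnit (H₂.coeff n))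
    (hn₂ : ∀ i < n, ¬ IsUnit (H₂.coeff i)) {d : B} {N : ℕ}
    (hd : ∀ k, 1 ≤ k → k ≤ N → d ∣ (shift π₂ (H₂.map (algebraMap A B))).coeff k)
    {k : ℕ} (hk1 : 1 ≤ k) (hk : k ≤ N) :
    d ∣ (shift π₁ (H₁.map (algebraMap A B))).coeff k := by
  -- `H₁ - α₁` and `H₂ ∘ (X g) - α₂` are both multiples of the minimal polynomial of `π₁`.
  -- Divisibility passes from `H₂` to the minimal polynomial because the cofactor `Q₂` is a unit at
  -- `π₁`, and from there to `H₁` whatever the cofactor.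
  obtain ⟨g, w, hg, hg0, hw0, hw⟩ := h.exists_aeval_X_mul_eq h₁ h₂
  have hC : ∀ (P : A[X]) (α : A), IsUnit (P.coeff n) → IsUnit ((P - C α).coeff n) := by
    intro P α hP
    rwa [coeff_sub, coeff_C_of_ne_zero h.pos.ne', sub_zero]
  obtain ⟨Q₁, hQ₁, -⟩ := h.exists_eq_mul_minpoly h₁ (P := H₁ - C α₁)
    (by rw [map_sub, hH₁, aeval_C, sub_self]) (hC _ _ hu₁)
  obtain ⟨Q₂, hQ₂, hQu⟩ := h.exists_eq_mul_minpoly h₁ (P := H₂.comp (X * g) - C α₂)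
    (by rw [map_sub, aeval_comp, hg, hH₂, aeval_C, sub_self]) (hC _ _ (by
      rw [← mul_one n]
      refine isUnit_coeff_comp one_pos hn₂ hu₂ ?_ ?_
      · intro i hi
        obtain rfl : i = 0 := by omega
        simp
      · rwa [mul_comm, ← zero_add 1, coeff_mul_X]))
  have e₂ : shift π₁ (Q₂.map (algebraMap A B)) * shift π₁ ((minpoly A π₁).map (algebraMap A B)) =
      (shift π₂ (H₂.map (algebraMap A B))).comp w -
        C ((shift π₂ (H₂.map (algebraMap A B))).coeff 0) := by
    rw [← shift_mul, ← Polynomial.map_mul, ← hQ₂, Polynomial.map_sub, Polynomial.map_comp,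
      shift_sub, shift_comp hw, map_C, shift_C, coeff_shift_zero, eval_map_algebraMap, hH₂]
  have hf : ∀ k ≤ N, d ∣ (shift π₁ ((minpoly A π₁).map (algebraMap A B))).coeff k := by
    intro k hk
    refine dvd_coeff_of_dvd_coeff_mul (P := shift π₁ (Q₂.map (algebraMap A B))) ?_ ?_ hk
    · rwa [coeff_shift_zero, eval_map_algebraMap]
    · intro k hk
      rw [e₂]
      exact dvd_coeff_comp hw0 hd hk
  have e₁ : shift π₁ (H₁.map (algebraMap A B)) = shift π₁ (Q₁.map (algebraMap A B)) *
      shift π₁ ((minpoly A π₁).map (algebraMap A B)) + C (algebraMap A B α₁) := by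
    rw [← shift_mul, ← Polynomial.map_mul, ← hQ₁, Polynomial.map_sub, shift_sub, map_C, shift_C,
      sub_add_cancel]
  rw [e₁, coeff_add, coeff_C_of_ne_zero (by omega), add_zero]
  exact dvd_coeff_mul hf hk

end Comparison

/-! ### Teichmüller representatives and expansions of uniformizers -/

section Teichmuller

variable {p : ℕ}

theorem map_mem_teichmullerReps {A B : Type*} [CommRing A] [CommRing B] (f : A →+* B) {a : A}
    (ha : a ∈ teichmullerReps p A) : f a ∈ teichmullerReps p B := fun k => by
  obtain ⟨b, hb⟩ := ha k
  exact ⟨f b, by rw [← map_pow, hb]⟩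

theorem TotRam.exists_teichmullerReps_sub {A₀ B : Type*} [CommRing A₀] [IsDomain A₀]
    [IsDiscreteValuationRing A₀] [CommRing B] [IsDomain B] [IsDiscreteValuationRing B] [Algebra A₀ B]
    {n₀ : ℕ} (h₀ : TotRam A₀ B n₀)
    (hT : ∀ a : A₀, ∃ t ∈ teichmullerReps p A₀, ¬ IsUnit (a - t)) {π : B} (hπ : Irreducible π)
    (b : B) : ∃ t ∈ teichmullerReps p A₀, π ∣ b - algebraMap A₀ B t := by
  obtain ⟨a, ha⟩ := h₀.residue b
  obtain ⟨t, ht, hat⟩ := hT a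
  refine ⟨t, ht, ?_⟩
  have h1 := (dvd_pow_self π h₀.pos.ne').trans (h₀.dvd_algebraMap hπ hat)
  rw [← dvd_iff_not_isUnit hπ] at ha
  rw [map_sub] at h1
  simpa using dvd_add ha h1

variable {B : Type*} [CommRing B] [IsDomain B] [IsDiscreteValuationRing B]

variable {A₀ A : Type*} [CommRing A₀] [IsDomain A₀] [IsDiscreteValuationRing A₀]
  [CommRing A] [IsDomain A] [IsDiscreteValuationRing A]
  [Algebra A₀ A] [Algebra A₀ B] [Algebra A B] [IsScalarTower A₀ A B] {n n₀ : ℕ}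

theorem TotRam.exists_expansion (h₀ : TotRam A₀ B n₀) (h : TotRam A B n)
    (hT : ∀ a : A₀, ∃ t ∈ teichmullerReps p A₀, ¬ IsUnit (a - t)) {πA : A} {πB : B}
    (hA : Irreducible πA) (hB : Irreducible πB) : ∃ a, IsExpansion p n πA πB a := by
  obtain ⟨u, hu⟩ := (h.assoc hA hB).symm
  choose t ht q hq using h₀.exists_teichmullerReps_sub hT hB
  -- `r k` is the remainder after `k` digits have been split off from the unit `u` with `πA = πB ^ n
  -- * u`.
  let r : ℕ → B := fun k => Nat.rec (u : B) (fun _ x => q x) k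
  have hr : ∀ k, r k = algebraMap A₀ B (t (r k)) + πB * r (k + 1) := fun k => by
    rw [← hq (r k)]
    ring
  refine ⟨fun k => algebraMap A₀ A (t (r k)), fun k => map_mem_teichmullerReps _ (ht _), ?_⟩
  intro N
  refine ⟨r N, ?_⟩
  induction N with
  | zero => simp [← hu, r]
  | succ N ih =>
    rw [sum_range_succ, ← sub_sub, ih, ← IsScalarTower.algebraMap_apply]
    linear_combination πB ^ (n + N) * hr N

theorem TotRam.isExpansion_coeffs (h₀ : TotRam A₀ B n₀) (h : TotRam A B n)
    (hT : ∀ a : A₀, ∃ t ∈ teichmullerReps p A₀, ¬ IsUnit (a - t)) {πA : A} {πB : B}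
    (hA : Irreducible πA) (hB : Irreducible πB) :
    IsExpansion p n πA πB (coeffs p n πA πB) := by
  have hex := h₀.exists_expansion h hT hA hB
  rw [coeffs, dif_pos hex]
  exact hex.choose_spec

variable [Fact p.Prime]

theorem exists_mem_teichmullerReps {A : Type*} [CommRing A] [IsLocalRing A]
    [IsAdicComplete (IsLocalRing.maximalIdeal A) A] [CharP (IsLocalRing.ResidueField A) p]
    [PerfectField (IsLocalRing.ResidueField A)] (a : A) :
    ∃ t ∈ teichmullerReps p A, ¬ IsUnit (a - t) := by
  have hc : CharP (A ⧸ IsLocalRing.maximalIdeal A) p :=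
    inferInstanceAs (CharP (IsLocalRing.ResidueField A) p)
  have hP : PerfectRing (IsLocalRing.ResidueField A) p := inferInstance
  have hP' : PerfectRing (A ⧸ IsLocalRing.maximalIdeal A) p := hP
  obtain ⟨x, hx⟩ := Perfection.coeff_surjective (p := p) (R := A ⧸ IsLocalRing.maximalIdeal A)
    (PerfectRing.bijective_frobenius (R := A ⧸ IsLocalRing.maximalIdeal A) (p := p)).surjective 0
    (Ideal.Quotient.mk _ a)
  refine ⟨Perfection.teichmuller p (IsLocalRing.maximalIdeal A) x,
    (mem_teichmullerReps_iff p A _).2 ⟨x, rfl⟩, ?_⟩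
  rw [← mem_nonunits_iff, ← IsLocalRing.mem_maximalIdeal, ← Ideal.Quotient.eq,
    Perfection.mk_teichmuller, hx]

theorem isUnit_of_mem_teichmullerReps {b : B} (hb : b ∈ teichmullerReps p B) (h0 : b ≠ 0) :
    IsUnit b := by
  by_contra h
  obtain ⟨π, hπ⟩ := IsDiscreteValuationRing.exists_irreducible B
  refine h0 (eq_zero_of_forall_pow_dvd hπ fun k => ?_)
  obtain ⟨c, rfl⟩ := hb k
  have hp : p.Prime := Fact.out
  have hc : π ∣ c := (dvd_iff_not_isUnit hπ c).2 fun hc => h (hc.pow _)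
  exact (pow_dvd_pow π (Nat.lt_pow_self hp.one_lt).le).trans (pow_dvd_pow_of_dvd hc _)

theorem pow_dvd_pow_prime_sub {R : Type*} [CommRing R] {π x y : R} (hp : π ∣ (p : R)) {k : ℕ}
    (hk : 1 ≤ k) (h : π ^ k ∣ x - y) : π ^ (k + 1) ∣ x ^ p - y ^ p := by
  have hpp : p.Prime := Fact.out
  obtain ⟨r, hr⟩ := exists_add_pow_prime_eq hpp (x - y) y
  rw [sub_add_cancel] at hr
  rw [show x ^ p - y ^ p = (x - y) ^ p + p * (x - y) * (y * r) by rw [hr]; ring]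
  refine dvd_add ?_ ?_
  · refine (pow_dvd_pow π ?_).trans ((pow_mul π k p).symm ▸ pow_dvd_pow_of_dvd h p)
    nlinarith [hpp.two_le]
  · rw [pow_succ']
    exact (mul_dvd_mul hp h).mul_right _

/-- Congruent `p ^ k`-th powers have congruent roots, by injectivity of Frobenius on the residue
field, and each `p`-th power taken on the way back improves the congruence by a factor `π`. -/
theorem eq_of_mem_teichmullerReps (hp : ¬ IsUnit (p : B)) {s t : B}
    (hs : s ∈ teichmullerReps p B) (ht : t ∈ teichmullerReps p B) (h : ¬ IsUnit (s - t)) :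
    s = t := by
  obtain ⟨π, hπ⟩ := IsDiscreteValuationRing.exists_irreducible B
  have hpp : p.Prime := Fact.out
  rw [← dvd_iff_not_isUnit hπ] at hp h
  refine sub_eq_zero.1 (eq_zero_of_forall_pow_dvd hπ fun k => ?_)
  obtain ⟨x, rfl⟩ := hs k
  obtain ⟨y, rfl⟩ := ht k
  have h1 : π ∣ x - y := by
    obtain ⟨r, hr⟩ := exists_add_pow_prime_pow_eq hpp (x - y) y k
    rw [sub_add_cancel] at hr
    rw [hr] at h
    refine hπ.prime.dvd_of_dvd_pow (n := p ^ k) ((dvd_add_left (b := (x - y) ^ p ^ k)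
      (c := p * ((x - y) * y * r)) (hp.mul_right _)).1 ?_)
    convert h using 1
    ring
  have h2 : ∀ j, π ^ (j + 1) ∣ x ^ p ^ j - y ^ p ^ j := by
    intro j
    induction j with
    | zero => simpa using h1
    | succ j ih =>
      rw [pow_succ p, pow_mul, pow_mul]
      exact pow_dvd_pow_prime_sub hp (by omega) ih
  exact (pow_dvd_pow π (Nat.le_succ k)).trans (h2 k)

/-- As the residue field does not grow, all representatives come from the bottom ring; this lets the
expansions of every step of a tower have coefficients there. -/
theorem TotRam.exists_eq_of_mem_teichmullerReps (h₀ : TotRam A₀ B n₀)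
    (hT : ∀ a : A₀, ∃ t ∈ teichmullerReps p A₀, ¬ IsUnit (a - t)) (hp : ¬ IsUnit (p : B)) {b : B}
    (hb : b ∈ teichmullerReps p B) : ∃ a : A₀, algebraMap A₀ B a = b := by
  obtain ⟨π, hπ⟩ := IsDiscreteValuationRing.exists_irreducible B
  obtain ⟨t, ht, hbt⟩ := h₀.exists_teichmullerReps_sub hT hπ b
  rw [dvd_iff_not_isUnit hπ] at hbt
  exact ⟨t, (eq_of_mem_teichmullerReps hp hb (map_mem_teichmullerReps _ ht) hbt).symm⟩

end Teichmuller

/-! ### `p`-adic valuations of binomial coefficients -/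

section Binomial

variable {p : ℕ} [Fact p.Prime]

theorem pow_padicValNat_sub_dvd_choose {N k : ℕ} (hN : N ≠ 0) (hk : k ≠ 0) :
    p ^ (padicValNat p N - padicValNat p k) ∣ N.choose k := by
  rcases eq_or_ne (N.choose k) 0 with h0 | h0
  · rw [h0]; exact dvd_zero _
  obtain ⟨N, rfl⟩ := Nat.exists_eq_succ_of_ne_zero hN
  obtain ⟨k, rfl⟩ := Nat.exists_eq_succ_of_ne_zero hk
  have h1 := Nat.add_one_mul_choose_eq N k
  have h2 : N.choose k ≠ 0 := fun h => by
    rw [h, mul_zero] at h1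
    exact (mul_ne_zero h0 (Nat.succ_ne_zero k)) h1.symm
  rw [padicValNat_dvd_iff_le h0]
  have h3 := congrArg (padicValNat p) h1
  rw [padicValNat.mul (Nat.succ_ne_zero N) h2, padicValNat.mul h0 (Nat.succ_ne_zero k)] at h3
  simp only [Nat.succ_eq_add_one] at *
  omega

/-- In base `p` both numbers end in `j` digits `p - 1`, which are all the digits of the lower one,
so Lucas' congruence strips them one at a time. -/
theorem not_dvd_choose_pred (j : ℕ) {q : ℕ} (hq : 0 < q) :
    ¬ p ∣ (p ^ j * q - 1).choose (p ^ j - 1) := by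
  have hp : p.Prime := Fact.out
  induction j with
  | zero => simpa using hp.one_lt.ne'
  | succ j ih =>
    have key : ∀ r, 0 < r → (p * r - 1) % p = p - 1 ∧ (p * r - 1) / p = r - 1 := by
      intro r hr
      obtain ⟨r, rfl⟩ := Nat.exists_eq_succ_of_ne_zero hr.ne'
      have : p * r.succ - 1 = (p - 1) + p * r := by
        have := hp.pos
        rw [Nat.mul_succ]
        omega
      have h1 := hp.pos
      rw [this, Nat.add_mul_mod_self_left, Nat.add_mul_div_left _ _ h1,
        Nat.mod_eq_of_lt (by omega), Nat.div_eq_of_lt (by omega)]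
      simp
    have h1 := key (p ^ j * q) (Nat.mul_pos (pow_pos hp.pos _) hq)
    have h2 := key (p ^ j) (pow_pos hp.pos _)
    have h3 := Choose.choose_modEq_choose_mod_mul_choose_div_nat
      (n := p * (p ^ j * q) - 1) (k := p * p ^ j - 1) (p := p)
    rw [h1.1, h1.2, h2.1, h2.2, Nat.choose_self, one_mul] at h3
    rw [pow_succ', mul_assoc]
    intro h
    exact ih ((h3.dvd_iff dvd_rfl).1 h)

theorem exists_choose_pow_eq {N j : ℕ} (hN : N ≠ 0) (hj : j ≤ padicValNat p N) :
    ∃ c, N.choose (p ^ j) = p ^ (padicValNat p N - j) * c ∧ ¬ p ∣ c := by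
  have hp : p.Prime := Fact.out
  have hpj : p ^ j ≠ 0 := pow_ne_zero _ hp.ne_zero
  obtain ⟨c, hc⟩ := pow_padicValNat_sub_dvd_choose (p := p) hN hpj
  rw [padicValNat.prime_pow] at hc
  refine ⟨c, hc, fun hpc => ?_⟩
  obtain ⟨q, hq⟩ : p ^ j ∣ N := (padicValNat_dvd_iff_le hN).2 hj
  have hq0 : 0 < q := Nat.pos_of_ne_zero fun h => hN (by rw [hq, h, mul_zero])
  have h1 := Nat.add_one_mul_choose_eq (N - 1) (p ^ j - 1)
  rw [Nat.sub_add_cancel (Nat.one_le_iff_ne_zero.2 hN),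
    Nat.sub_add_cancel (Nat.one_le_iff_ne_zero.2 hpj), hc] at h1
  obtain ⟨d, rfl⟩ := hpc
  obtain ⟨N', hN'⟩ : p ^ padicValNat p N ∣ N := pow_padicValNat_dvd
  have h2 : N' * (N - 1).choose (p ^ j - 1) = p * d := by
    have h3 : p ^ padicValNat p N = p ^ (padicValNat p N - j) * p ^ j := by
      rw [← pow_add, Nat.sub_add_cancel hj]
    refine Nat.eq_of_mul_eq_mul_left (pow_pos hp.pos (padicValNat p N)) ?_
    calc _ = N * (N - 1).choose (p ^ j - 1) := by rw [← mul_assoc, ← hN']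
      _ = _ := by rw [h1, h3]; ring
  rcases (hp.dvd_mul).1 (Dvd.intro _ h2.symm) with h4 | h4
  · refine pow_succ_padicValNat_not_dvd hN (p := p) ?_
    rw [pow_succ]
    conv_rhs => rw [hN']
    exact mul_dvd_mul_left _ h4
  · rw [hq] at h4
    exact not_dvd_choose_pred j hq0 h4

end Binomial

/-! ### The indices of inseparability as a minimum over the expansion -/

section Index

variable {A B : Type*} [CommRing A] [CommRing B] [Algebra A B] {p n : ℕ} {πA : A} {πB : B}

/-- Together with `exists_le_index` this turns the two-stage minimum into a single one, over all `h`
with `a_h ≠ 0`, of `h + max (v_p(h + n) - j) 0 * v(p)`; truncated subtraction supplies the `max`. -/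
theorem index_le {h j : ℕ} (hc : coeffs p n πA πB h ≠ 0) (h0 : coeffs p n πA πB 0 ≠ 0)
    (hj : j ≤ padicValNat p n) : index p n πA πB j ≤
      h + ((padicValNat p (h + n) - j : ℕ) : ℕ∞) * emultiplicity πB (p : B) := by
  have key : ∀ j₁ h, j ≤ j₁ → j₁ ≤ padicValNat p n → padicValNat p (h + n) ≤ j₁ →
      coeffs p n πA πB h ≠ 0 →
      index p n πA πB j ≤ h + ((j₁ - j : ℕ) : ℕ∞) * emultiplicity πB (p : B) := by
    intro j₁ h h1 h2 h3 h4
    refine (Finset.inf_le (mem_Icc.2 ⟨h1, h2⟩)).trans (add_le_add_left ?_ _)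
    exact iInf₂_le h ⟨h3, h4⟩
  rcases le_total (padicValNat p (h + n)) (padicValNat p n) with h1 | h1
  · rcases le_total j (padicValNat p (h + n)) with h2 | h2
    · exact key _ h h2 h1 le_rfl hc
    · have := key j h le_rfl hj h2 hc
      rwa [Nat.sub_eq_zero_of_le h2, ← Nat.sub_self j]
  -- Here `v_p(h + n)` exceeds the range of `j₁`, but the term `h = 0`, with `v_p(n)` in place of
  -- `v_p(h + n)`, is already no larger.
  · refine (key _ 0 hj le_rfl (by rw [zero_add]) h0).trans ?_
    gcongr
    simp

theorem exists_le_index {j : ℕ} (hi : index p n πA πB j ≠ ⊤) :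
    ∃ h, coeffs p n πA πB h ≠ 0 ∧
      h + ((padicValNat p (h + n) - j : ℕ) : ℕ∞) * emultiplicity πB (p : B)
        ≤ index p n πA πB j := by
  have hne : (Icc j (padicValNat p n)).Nonempty := by
    rw [nonempty_iff_ne_empty]
    intro h
    rw [index, h, inf_empty] at hi
    exact hi rfl
  obtain ⟨j₁, -, hj₁⟩ := exists_mem_eq_inf _ hne (fun j₁ =>
    preIndex p n πA πB j₁ + ((j₁ - j : ℕ) : ℕ∞) * emultiplicity πB (p : B))
  change index p n πA πB j = _ at hj₁
  have h1 : preIndex p n πA πB j₁ ≠ ⊤ := fun h => by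
    rw [hj₁, h, top_add] at hi
    exact hi rfl
  rw [preIndex, ← sInf_image] at h1
  set S : Set ℕ := {h : ℕ | padicValNat p (h + n) ≤ j₁ ∧ coeffs p n πA πB h ≠ 0} with hS
  have hSne : S.Nonempty := by
    rw [Set.nonempty_iff_ne_empty]
    intro h
    rw [h, Set.image_empty, sInf_empty] at h1
    exact h1 rfl
  obtain ⟨h, hh, hh'⟩ := csInf_mem (hSne.image (fun h : ℕ => (h : ℕ∞)))
  refine ⟨h, hh.2, ?_⟩
  rw [hj₁, preIndex, ← hS, ← sInf_image, ← hh']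
  have := hh.1
  gcongr

/-- The indices of inseparability as natural numbers. -/
noncomputable def idx (p n : ℕ) (πA : A) (πB : B) (j : ℕ) : ℕ := (index p n πA πB j).toNat

/-- The infimum is empty and `toNat` sends `∞` to `0`. This default continues the sequence
correctly, since it already vanishes at `v_p(n)`, so later inequalities need no range condition. -/
theorem idx_of_lt {j : ℕ} (hj : padicValNat p n < j) : idx p n πA πB j = 0 := by
  rw [idx, index, Icc_eq_empty (by omega), inf_empty, ENat.toNat_top]

theorem index_ne_top (h0 : coeffs p n πA πB 0 ≠ 0) (hfin : index p n πA πB 0 ≠ ⊤) {j : ℕ}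
    (hj : j ≤ padicValNat p n) : index p n πA πB j ≠ ⊤ := by
  obtain ⟨h, hc, hh⟩ := exists_le_index hfin
  refine ne_top_of_le_ne_top hfin (((index_le hc h0 hj).trans ?_).trans hh)
  gcongr
  omega

theorem coe_idx (h0 : coeffs p n πA πB 0 ≠ 0) (hfin : index p n πA πB 0 ≠ ⊤) {j : ℕ}
    (hj : j ≤ padicValNat p n) : (idx p n πA πB j : ℕ∞) = index p n πA πB j :=
  ENat.natCast_toNat (index_ne_top h0 hfin hj)

theorem idx_le (h0 : coeffs p n πA πB 0 ≠ 0) (hfin : index p n πA πB 0 ≠ ⊤) {h : ℕ}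
    (hc : coeffs p n πA πB h ≠ 0) (j : ℕ) : (idx p n πA πB j : ℕ∞) ≤
      h + ((padicValNat p (h + n) - j : ℕ) : ℕ∞) * emultiplicity πB (p : B) := by
  rcases le_or_gt j (padicValNat p n) with hj | hj
  · rw [coe_idx h0 hfin hj]
    exact index_le hc h0 hj
  · rw [idx_of_lt hj]
    simp

theorem exists_eq_idx (h0 : coeffs p n πA πB 0 ≠ 0) (hfin : index p n πA πB 0 ≠ ⊤) {j : ℕ}
    (hj : j ≤ padicValNat p n) : ∃ h, coeffs p n πA πB h ≠ 0 ∧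
      h + ((padicValNat p (h + n) - j : ℕ) : ℕ∞) * emultiplicity πB (p : B)
        = idx p n πA πB j := by
  obtain ⟨h, hc, hh⟩ := exists_le_index (index_ne_top h0 hfin hj)
  rw [← coe_idx h0 hfin hj] at hh
  exact ⟨h, hc, le_antisymm hh (idx_le h0 hfin hc j)⟩

theorem idx_antitone (h0 : coeffs p n πA πB 0 ≠ 0) (hfin : index p n πA πB 0 ≠ ⊤) :
    Antitone (idx p n πA πB) := by
  intro j j' hjj
  rcases le_or_gt j' (padicValNat p n) with hj | hj
  · obtain ⟨h, hc, hh⟩ := exists_eq_idx h0 hfin (hjj.trans hj)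
    rw [← Nat.cast_le (α := ℕ∞), ← hh]
    refine (idx_le h0 hfin hc j').trans ?_
    gcongr
  · rw [idx_of_lt hj]
    exact Nat.zero_le _

theorem idx_le_add (h0 : coeffs p n πA πB 0 ≠ 0) (hfin : index p n πA πB 0 ≠ ⊤) {j j' : ℕ}
    (hjj : j ≤ j') : (idx p n πA πB j : ℕ∞) ≤
      idx p n πA πB j' + ((j' - j : ℕ) : ℕ∞) * emultiplicity πB (p : B) := by
  have key : ∀ j', j ≤ j' → j' ≤ padicValNat p n → (idx p n πA πB j : ℕ∞) ≤
      idx p n πA πB j' + ((j' - j : ℕ) : ℕ∞) * emultiplicity πB (p : B) := by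
    intro j' hjj hj
    obtain ⟨h, hc, hh⟩ := exists_eq_idx h0 hfin hj
    rw [← hh, add_assoc, ← add_mul, ← Nat.cast_add]
    refine (idx_le h0 hfin hc j).trans ?_
    gcongr
    omega
  rcases le_or_gt j' (padicValNat p n) with hj | hj
  · exact key j' hjj hj
  · rcases le_or_gt j (padicValNat p n) with hj' | hj'
    · refine (key _ hj' le_rfl).trans (add_le_add ?_ ?_)
      · obtain ⟨h, hc, hh⟩ := exists_eq_idx h0 hfin (le_refl (padicValNat p n))
        have := idx_le h0 hfin h0 (padicValNat p n)
        simp only [zero_add, tsub_self, Nat.cast_zero, zero_mul, nonpos_iff_eq_zero] at this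
        rw [this]
        exact bot_le
      · gcongr
    · rw [idx_of_lt hj']
      simp

theorem idx_eq_zero_iff (h0 : coeffs p n πA πB 0 ≠ 0) (hfin : index p n πA πB 0 ≠ ⊤)
    (hem : emultiplicity πB (p : B) ≠ 0) {j : ℕ} :
    idx p n πA πB j = 0 ↔ padicValNat p n ≤ j := by
  refine ⟨fun h1 => ?_, fun h1 => ?_⟩
  · by_contra! hj
    obtain ⟨h, hc, hh⟩ := exists_eq_idx h0 hfin hj.le
    rw [h1, Nat.cast_zero, add_eq_zero, mul_eq_zero] at hh
    obtain ⟨h2, h3 | h3⟩ := hh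
    · rw [Nat.cast_eq_zero] at h2 h3
      rw [h2, zero_add] at h3
      omega
    · exact hem h3
  · have := idx_le h0 hfin h0 j
    rw [zero_add, Nat.sub_eq_zero_of_le h1] at this
    simpa using this

/-- Where the sequence drops, the minimum is attained by a single `h`. Terms with `v_p(h + n) < j`
are too large because they already bound the preceding index; a tie among the others is excluded
because `p ^ v_p(n)` divides `v(p)` when the latter is finite. -/
theorem exists_strict_idx [Fact p.Prime] (hn : 0 < n) (h0 : coeffs p n πA πB 0 ≠ 0)
    (hfin : index p n πA πB 0 ≠ ⊤)
    (hem : emultiplicity πB (p : B) ≠ 0)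
    (hdvd : ∀ e : ℕ, emultiplicity πB (p : B) = e → n ∣ e) {j : ℕ} (hj : j ≤ padicValNat p n)
    (hs : ∀ j' < j, idx p n πA πB j < idx p n πA πB j') :
    ∃ h, coeffs p n πA πB h ≠ 0 ∧ j ≤ padicValNat p (h + n) ∧
      h + ((padicValNat p (h + n) - j : ℕ) : ℕ∞) * emultiplicity πB (p : B)
        = idx p n πA πB j ∧
      ∀ h', h' ≠ h → coeffs p n πA πB h' ≠ 0 → ((idx p n πA πB j + 1 : ℕ) : ℕ∞) ≤
        h' + ((padicValNat p (h' + n) - j : ℕ) : ℕ∞) * emultiplicity πB (p : B) := by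
  have hlow : ∀ h, coeffs p n πA πB h ≠ 0 → padicValNat p (h + n) < j → idx p n πA πB j < h := by
    intro h hc hh
    have := idx_le h0 hfin hc (j - 1)
    rw [Nat.sub_eq_zero_of_le (by omega : padicValNat p (h + n) ≤ j - 1)] at this
    simp only [Nat.cast_zero, zero_mul, add_zero, Nat.cast_le] at this
    exact (hs (j - 1) (by omega)).trans_le this
  obtain ⟨h, hc, hh⟩ := exists_eq_idx h0 hfin hj
  have hjh : j ≤ padicValNat p (h + n) := by
    by_contra! hlt
    have h1 := hlow h hc hlt
    rw [Nat.sub_eq_zero_of_le hlt.le] at hh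
    simp only [Nat.cast_zero, zero_mul, add_zero, Nat.cast_inj] at hh
    omega
  refine ⟨h, hc, hjh, hh, fun h' hne hc' => ?_⟩
  rcases lt_or_ge (padicValNat p (h' + n)) j with hlt | hge
  · have := hlow h' hc' hlt
    rw [Nat.sub_eq_zero_of_le hlt.le]
    simp only [Nat.cast_zero, zero_mul, add_zero, Nat.cast_le]
    omega
  · rw [Nat.cast_add, Nat.cast_one, ENat.add_one_le_iff (ENat.natCast_ne_top _)]
    refine lt_of_le_of_ne (idx_le h0 hfin hc' j) fun heq => hne ?_
    rcases eq_or_ne (emultiplicity πB (p : B)) ⊤ with htop | htop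
    · have h1 : ∀ (a b c : ℕ), (a : ℕ∞) + b * emultiplicity πB (p : B) = c → b = 0 ∧ a = c := by
        intro a b c habc
        rcases Nat.eq_zero_or_pos b with rfl | hb
        · exact ⟨rfl, by simpa using habc⟩
        · rw [htop, ENat.mul_top (by simpa using hb.ne'), add_top] at habc
          exact absurd habc.symm (ENat.natCast_ne_top _)
      rw [(h1 _ _ _ hh).2, (h1 _ _ _ heq.symm).2]
    · obtain ⟨e, he⟩ := ENat.ne_top_iff_exists.1 htop
      have hne' := hdvd e he.symm
      have hpe : p ^ padicValNat p n ∣ e := pow_padicValNat_dvd.trans hne'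
      rw [← he] at hh heq hem
      have he0 : e ≠ 0 := by simpa using hem
      norm_cast at hh heq
      have hmin := idx_le h0 hfin h0 j
      rw [← he, zero_add] at hmin
      norm_cast at hmin
      set s := padicValNat p (h + n) with hs_def
      set s' := padicValNat p (h' + n) with hs'_def
      have hds : ∀ t, t ≤ s → p ^ t ∣ h + n := fun t ht =>
        (padicValNat_dvd_iff_le (by omega)).2 ht
      have hds' : ∀ t, t ≤ s' → p ^ t ∣ h' + n := fun t ht =>
        (padicValNat_dvd_iff_le (by omega)).2 ht
      have hh2 : h + (s - j) * e = h' + (s' - j) * e := hh.trans heq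
      rcases lt_trichotomy s s' with hss | hss | hss
      · exfalso
        have h2 : h + n = h' + n + (s' - s) * e := by
          have : s' - j = (s' - s) + (s - j) := by omega
          rw [this, add_mul] at hh2
          omega
        -- If `s < v_p(n)`, then `p ^ (s + 1)` divides `h' + n` and `e`, hence `h + n`, against the
        -- definition of `s`. Otherwise the value at `h'` exceeds the bound `(v_p(n) - j) * e` given
        -- by the term `h = 0`.
        rcases lt_or_ge s (padicValNat p n) with h3 | h3
        · have h4 : p ^ (s + 1) ∣ h + n := by
            rw [h2]
            exact dvd_add (hds' _ hss) ((pow_dvd_pow p h3).trans hpe |>.mul_left _)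
          have := (padicValNat_dvd_iff_le (by omega)).1 h4
          omega
        · have h4 : (padicValNat p n - j) * e ≤ (s - j) * e := by gcongr
          have h5 : 0 < (s' - s) * e := Nat.mul_pos (by omega) (by omega)
          omega
      · rw [hss] at hh2
        omega
      · exfalso
        have h2 : h' + n = h + n + (s - s') * e := by
          have : s - j = (s - s') + (s' - j) := by omega
          rw [this, add_mul] at hh2
          omega
        rcases lt_or_ge s' (padicValNat p n) with h3 | h3
        · have h4 : p ^ (s' + 1) ∣ h' + n := by
            rw [h2]
            exact dvd_add (hds _ hss) ((pow_dvd_pow p h3).trans hpe |>.mul_left _)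
          have := (padicValNat_dvd_iff_le (by omega)).1 h4
          omega
        · have h4 : (padicValNat p n - j) * e ≤ (s' - j) * e := by gcongr
          have h5 : 0 < (s - s') * e := Nat.mul_pos (by omega) (by omega)
          omega

end Index

/-! ### Valuations of the terms of an expansion -/

section Valuation

theorem coeff_shift_truncation {A₀ B : Type*} [CommRing A₀] [CommRing B] [Algebra A₀ B]
    {πB : B} {n : ℕ} {F : A₀[X]} {D : B[X]} {N T : ℕ} {c : ℕ → B}
    (hF : F.map (algebraMap A₀ B) = ∑ h ∈ range N, C (c h) * X ^ (h + n) + C (πB ^ T) * D)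
    (k : ℕ) : (shift πB (F.map (algebraMap A₀ B))).coeff k =
      ∑ h ∈ range N, c h * πB ^ (h + n) * ((h + n).choose k : B) +
        πB ^ T * (shift πB D).coeff k := by
  rw [hF, shift_add, shift_mul, shift_C, shift_sum, coeff_add, coeff_C_mul, finsetSum_coeff]
  simp only [coeff_shift_monomial]

variable {p : ℕ} [Fact p.Prime] {B : Type*} [CommRing B] [IsDomain B]
  [IsDiscreteValuationRing B] {π : B}

theorem emultiplicity_pow_mul_pow (hπ : Irreducible π) (h t : ℕ) (x : B) :
    emultiplicity π (π ^ h * x ^ t) = h + t * emultiplicity π x := by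
  rw [emultiplicity_mul hπ.prime, emultiplicity_pow_self hπ.ne_zero hπ.not_isUnit,
    emultiplicity_pow hπ.prime]

theorem emultiplicity_eq_top_iff (hπ : Irreducible π) {x : B} : emultiplicity π x = ⊤ ↔ x = 0 := by
  refine ⟨fun h => eq_zero_of_forall_pow_dvd hπ fun k => ?_, fun h => by rw [h, emultiplicity_zero]⟩
  rw [pow_dvd_iff_le_emultiplicity, h]
  exact le_top

theorem isUnit_natCast {R : Type*} [CommRing R] [IsLocalRing R] (hp : ¬ IsUnit (p : R)) {c : ℕ}
    (hc : ¬ p ∣ c) : IsUnit (c : R) := by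
  have hpp : p.Prime := Fact.out
  by_contra h
  have h1 : IsCoprime (p : ℤ) (c : ℤ) :=
    Nat.isCoprime_iff_coprime.2 ((Nat.Prime.coprime_iff_not_dvd hpp).2 hc)
  have h2 := h1.map (Int.castRingHom R)
  simp only [eq_intCast, Int.cast_natCast] at h2
  obtain ⟨a, b, hab⟩ := h2
  have h3 : a * p + b * c ∈ IsLocalRing.maximalIdeal R :=
    Ideal.add_mem _ (Ideal.mul_mem_left _ _ ((IsLocalRing.mem_maximalIdeal _).2 hp))
      (Ideal.mul_mem_left _ _ ((IsLocalRing.mem_maximalIdeal _).2 h))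
  rw [hab] at h3
  exact (IsLocalRing.mem_maximalIdeal _).1 h3 isUnit_one

theorem padicValNat_le_of_le_pow {k j : ℕ} (hk : 1 ≤ k) (h : k ≤ p ^ j) : padicValNat p k ≤ j := by
  have hpp : p.Prime := Fact.out
  have h1 : p ^ padicValNat p k ≤ k := Nat.le_of_dvd hk pow_padicValNat_dvd
  exact (Nat.pow_le_pow_iff_right hpp.one_lt).1 (h1.trans h)

end Valuation

/-! ### Indices of inseparability as valuations of coefficients -/

section GoodPolynomial

variable {p : ℕ} {A₀ A B : Type*} [CommRing A₀] [IsDomain A₀] [IsDiscreteValuationRing A₀]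
  [CommRing A] [IsDomain A] [IsDiscreteValuationRing A]
  [CommRing B] [IsDomain B] [IsDiscreteValuationRing B]
  [Algebra A₀ A] [Algebra A₀ B] [Algebra A B] [IsScalarTower A₀ A B] {n n₀ : ℕ}
  {πA : A} {πB : B}

theorem TotRam.coeffs_zero_ne_zero (h₀ : TotRam A₀ B n₀) (h : TotRam A B n)
    (hT : ∀ a : A₀, ∃ t ∈ teichmullerReps p A₀, ¬ IsUnit (a - t))
    (hA : Irreducible πA) (hB : Irreducible πB) : coeffs p n πA πB 0 ≠ 0 := by
  intro h0
  have h1 := (h₀.isExpansion_coeffs h hT hA hB).2 1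
  rw [sum_range_one, h0, map_zero, zero_mul, sub_zero] at h1
  have h2 := h1.trans (h.assoc hA hB).dvd
  rw [pow_dvd_pow_iff hB.ne_zero hB.not_isUnit] at h2
  omega

variable [Fact p.Prime]

/-- The truncated expansion, with an exact value at `πB`. -/
theorem TotRam.exists_truncation (h₀ : TotRam A₀ B n₀) (h : TotRam A B n)
    (hT : ∀ a : A₀, ∃ t ∈ teichmullerReps p A₀, ¬ IsUnit (a - t)) (hp : ¬ IsUnit (p : B))
    (hA : Irreducible πA) (hB : Irreducible πB) (T : ℕ) :
    ∃ (F : A₀[X]) (D : B[X]), aeval πB F = algebraMap A B πA ∧ F.map (algebraMap A₀ B) =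
      ∑ h ∈ range (n₀ * T), C (algebraMap A B (coeffs p n πA πB h)) * X ^ (h + n) +
        C (πB ^ T) * D := by
  have hexp := h₀.isExpansion_coeffs h hT hA hB
  have ha : ∀ h, ∃ a : A₀, algebraMap A₀ B a = algebraMap A B (coeffs p n πA πB h) := fun k =>
    h₀.exists_eq_of_mem_teichmullerReps hT hp (map_mem_teichmullerReps _ (hexp.1 k))
  choose a ha using ha
  obtain ⟨ϖ, hϖ⟩ := IsDiscreteValuationRing.exists_irreducible A₀
  have hass := (h₀.assoc hϖ hB).pow_pow (n := T)
  rw [← pow_mul] at hass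
  -- After `n₀ * T` terms the remainder is divisible by `ϖ ^ T`. Writing the quotient as a
  -- polynomial `D` in `πB` over `A₀` makes the value at `πB` exact, while all coefficients of the
  -- tail stay divisible by `πB ^ T`.
  obtain ⟨c, hc⟩ := hass.dvd.trans ((pow_dvd_pow πB (Nat.le_add_left _ _)).trans (hexp.2 (n₀ * T)))
  obtain ⟨D, hD⟩ := h₀.exists_aeval_eq hB c
  obtain ⟨y, hy⟩ := (pow_dvd_pow πB (Nat.le_mul_of_pos_left T h₀.pos)).trans hass.symm.dvd
  refine ⟨∑ h ∈ range (n₀ * T), C (a h) * X ^ (h + n) + C (ϖ ^ T) * D,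
    C y * D.map (algebraMap A₀ B), ?_, ?_⟩
  · simp only [map_add, map_sum, map_mul, map_pow, aeval_C, aeval_X, hD, ha]
    linear_combination -hc
  · simp only [Polynomial.map_add, Polynomial.map_sum, Polynomial.map_mul, Polynomial.map_pow,
      map_C, map_X, ha, ← mul_assoc, ← C_mul]
    rw [map_pow, hy]

theorem TotRam.coeff_truncation (h₀ : TotRam A₀ B n₀) (hB : Irreducible πB) {F : A₀[X]} {D : B[X]}
    {N T : ℕ} {c : ℕ → B} (hN : 0 < N) (hT : 0 < T) (hc : IsUnit (c 0))
    (hF : F.map (algebraMap A₀ B) = ∑ h ∈ range N, C (c h) * X ^ (h + n) + C (πB ^ T) * D) :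
    (∀ i < n, ¬ IsUnit (F.coeff i)) ∧ IsUnit (F.coeff n) := by
  have key : ∀ i, algebraMap A₀ B (F.coeff i) =
      (∑ h ∈ range N, if i = h + n then c h else 0) + πB ^ T * D.coeff i := by
    intro i
    rw [← coeff_map, hF, coeff_add, coeff_C_mul, finsetSum_coeff]
    simp only [coeff_C_mul, coeff_X_pow, mul_ite, mul_one, mul_zero]
  have hd : ∀ i, πB ∣ πB ^ T * D.coeff i := fun i => (dvd_pow_self πB hT.ne').mul_right _
  refine ⟨fun i hi hu => ?_, ?_⟩
  · have h1 := hu.map (algebraMap A₀ B)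
    rw [key, sum_eq_zero fun h _ => if_neg (by omega), zero_add] at h1
    exact (dvd_iff_not_isUnit hB _).1 (hd i) h1
  · refine h₀.isUnit_of_not_dvd hB ?_
    rw [key, dvd_add_left (hd n), sum_eq_single 0 (fun h _ hh => if_neg (by omega))
      (fun hh => absurd (mem_range.2 hN) hh), if_pos (zero_add n).symm, dvd_iff_not_isUnit hB]
    exact not_not.2 hc

theorem TotRam.isUnit_coeffs (h₀ : TotRam A₀ B n₀) (h : TotRam A B n)
    (hT : ∀ a : A₀, ∃ t ∈ teichmullerReps p A₀, ¬ IsUnit (a - t))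
    (hA : Irreducible πA) (hB : Irreducible πB) {k : ℕ} (hk : coeffs p n πA πB k ≠ 0) :
    IsUnit (algebraMap A B (coeffs p n πA πB k)) :=
  (isUnit_of_mem_teichmullerReps ((h₀.isExpansion_coeffs h hT hA hB).1 k) hk).map _

/-- The coefficient of `u` in `F(π(1 + u))` is `π F'(π)`. Were the index infinite, every term `(h +
n) a_h π ^ (h + n)` would vanish and the derivative of the minimal polynomial would be zero at `π`,
against separability. -/
theorem TotRam.index_zero_ne_top (h : TotRam A B n)
    (hT : ∀ a : A, ∃ t ∈ teichmullerReps p A, ¬ IsUnit (a - t)) (hp : ¬ IsUnit (p : B))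
    (hA : Irreducible πA) (hB : Irreducible πB) : index p n πA πB 0 ≠ ⊤ := by
  intro htop
  have h0 := h.coeffs_zero_ne_zero h hT hA hB
  have hterm : ∀ k, algebraMap A B (coeffs p n πA πB k) * πB ^ (k + n) *
      ((k + n).choose 1 : B) = 0 := by
    intro k
    rcases eq_or_ne (coeffs p n πA πB k) 0 with hk | hk
    · rw [hk, map_zero, zero_mul, zero_mul]
    · have h1 := index_le hk h0 (Nat.zero_le (padicValNat p n))
      rw [htop, top_le_iff, Nat.sub_zero] at h1
      have h3 : padicValNat p (k + n) ≠ 0 := fun h3 => by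
        rw [h3, Nat.cast_zero, zero_mul, add_zero] at h1
        exact ENat.natCast_ne_top k h1
      have h4 : emultiplicity πB (p : B) = ⊤ := by
        by_contra h4
        obtain ⟨e, he⟩ := ENat.ne_top_iff_exists.1 h4
        rw [← he] at h1
        exact ENat.natCast_ne_top (k + padicValNat p (k + n) * e) (by exact_mod_cast h1)
      rw [emultiplicity_eq_top_iff hB] at h4
      obtain ⟨q, hq⟩ := dvd_of_one_le_padicValNat (Nat.one_le_iff_ne_zero.2 h3)
      rw [Nat.choose_one_right, hq, Nat.cast_mul, h4, zero_mul, mul_zero]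
  have key : ∀ T, πB ^ T ∣ πB * aeval πB (derivative (minpoly A πB)) := by
    intro T
    obtain ⟨F, D, hF, hFD⟩ := h.exists_truncation h hT hp hA hB (T + 1)
    obtain ⟨-, hu⟩ := h.coeff_truncation hB (Nat.mul_pos h.pos T.succ_pos) T.succ_pos
      (h.isUnit_coeffs h hT hA hB h0) hFD
    obtain ⟨Q, hQ, hQu⟩ := h.exists_eq_mul_minpoly hB (P := F - C πA)
      (by rw [map_sub, hF, aeval_C, sub_self])
      (by rwa [coeff_sub, coeff_C_of_ne_zero h.pos.ne', sub_zero])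
    have h1 := coeff_shift_truncation hFD 1
    rw [sum_eq_zero fun k _ => hterm k, zero_add, coeff_shift_one, derivative_map,
      eval_map_algebraMap] at h1
    have h2 : derivative F = derivative (Q * minpoly A πB) := by
      rw [← hQ, derivative_sub, derivative_C, sub_zero]
    rw [h2, derivative_mul, map_add, map_mul, map_mul, minpoly.aeval, mul_zero, zero_add,
      mul_left_comm] at h1
    refine (pow_dvd_pow πB T.le_succ).trans (hQu.dvd_mul_left.1 ?_)
    rw [h1]
    exact dvd_mul_right _ _
  exact mul_ne_zero hB.ne_zero (h.sep πB) (eq_zero_of_forall_pow_dvd hB key)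

theorem TotRam.dvd_of_emultiplicity_eq (h : TotRam A B n) (hB : Irreducible πB) {e : ℕ} (x : A)
    (he : emultiplicity πB (algebraMap A B x) = e) : n ∣ e := by
  obtain ⟨ϖ, hϖ⟩ := IsDiscreteValuationRing.exists_irreducible A
  rcases eq_or_ne x 0 with rfl | hx
  · rw [map_zero, emultiplicity_zero] at he
    exact absurd he.symm (ENat.natCast_ne_top e)
  obtain ⟨k, u, rfl⟩ := IsDiscreteValuationRing.eq_unit_mul_pow_irreducible hx hϖ
  have h1 : Associated (algebraMap A B (u * ϖ ^ k)) (πB ^ (n * k)) := by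
    rw [map_mul, map_pow, pow_mul]
    exact (associated_unit_mul_left _ _ (u.isUnit.map _)).trans (h.assoc hϖ hB).pow_pow
  rw [emultiplicity_eq_of_associated_right h1, emultiplicity_pow_self hB.ne_zero hB.not_isUnit,
    Nat.cast_inj] at he
  exact ⟨k, he.symm⟩

/-- The coefficient of `u ^ k` is essentially `∑ a_h (h + n choose k) πB ^ (h + n)`. The binomial is
divisible by `p` to the power `v_p(h + n) - v_p(k)`, exactly so for `k = p ^ j` with `j ≤ v_p(h +
n)`, so the valuations of the terms are bounded by the quantities whose minimum is the index.
Coefficients lie in `A₀`, not merely `A`, so that the polynomials of successive steps can be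
composed. -/
theorem TotRam.exists_good_polynomial (h₀ : TotRam A₀ B n₀) (h : TotRam A B n)
    (hT : ∀ a : A₀, ∃ t ∈ teichmullerReps p A₀, ¬ IsUnit (a - t)) (hp : ¬ IsUnit (p : B))
    (hA : Irreducible πA) (hB : Irreducible πB) (hfin : index p n πA πB 0 ≠ ⊤) :
    ∃ F : A₀[X], aeval πB F = algebraMap A B πA ∧ (∀ i < n, ¬ IsUnit (F.coeff i)) ∧
      IsUnit (F.coeff n) ∧
      (∀ k, 1 ≤ k → πB ^ (n + idx p n πA πB (padicValNat p k)) ∣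
        (shift πB (F.map (algebraMap A₀ B))).coeff k) ∧
      ∀ j ≤ padicValNat p n, (∀ j' < j, idx p n πA πB j < idx p n πA πB j') →
        ¬ πB ^ (n + idx p n πA πB j + 1) ∣ (shift πB (F.map (algebraMap A₀ B))).coeff (p ^ j) := by
  have hpp : p.Prime := Fact.out
  have h0 := h₀.coeffs_zero_ne_zero h hT hA hB
  have hem : emultiplicity πB (p : B) ≠ 0 := emultiplicity_ne_zero.2 ((dvd_iff_not_isUnit hB _).2 hp)
  have hanti := idx_antitone h0 hfin
  set i := idx p n πA πB with hi
  -- `i 0` is the largest index, so the tail is divisible by every power of `πB` tested below.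
  set T := n + i 0 + 1 with hTdef
  obtain ⟨F, D, hF, hFD⟩ := h₀.exists_truncation h hT hp hA hB T
  obtain ⟨hlow, hu⟩ := h₀.coeff_truncation hB (Nat.mul_pos h₀.pos (Nat.succ_pos _))
    (Nat.succ_pos _) (h₀.isUnit_coeffs h hT hA hB h0) hFD
  have hterm : ∀ (k t y : ℕ), 1 ≤ k → (y : ℕ∞) ≤
      t + ((padicValNat p (t + n) - padicValNat p k : ℕ) : ℕ∞) * emultiplicity πB (p : B) →
      πB ^ (n + y) ∣ algebraMap A B (coeffs p n πA πB t) * πB ^ (t + n) *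
        ((t + n).choose k : B) := by
    intro k t y hk hy
    rw [← emultiplicity_pow_mul_pow hB, ← pow_dvd_iff_le_emultiplicity] at hy
    have h1 : (p : B) ^ (padicValNat p (t + n) - padicValNat p k) ∣ ((t + n).choose k : B) := by
      have := pow_padicValNat_sub_dvd_choose (p := p) (N := t + n) (k := k)
        (by have := h.pos; omega) (by omega)
      simpa using Nat.cast_dvd_cast (α := B) this
    rw [mul_assoc, add_comm t n, pow_add, pow_add, mul_assoc]
    exact (mul_dvd_mul_left _ (hy.trans (mul_dvd_mul_left _ (by rwa [add_comm n t])))).mul_left _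
  refine ⟨F, hF, hlow, hu, fun k hk => ?_, fun j hj hs hdvd => ?_⟩
  · rw [coeff_shift_truncation hFD]
    refine dvd_add (dvd_sum fun t _ => ?_) ?_
    · rcases eq_or_ne (coeffs p n πA πB t) 0 with ht | ht
      · rw [ht, map_zero, zero_mul, zero_mul]
        exact dvd_zero _
      · exact hterm k t _ hk (idx_le h0 hfin ht _)
    · refine (pow_dvd_pow πB ?_).mul_right _
      have := hanti (Nat.zero_le (padicValNat p k))
      omega
  · obtain ⟨t, hct, hjt, ht, hother⟩ := exists_strict_idx h.pos h0 hfin hem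
      (fun e he => h.dvd_of_emultiplicity_eq hB (p : A) (by rw [map_natCast, he])) hj hs
    rw [← hi] at ht hother
    have htT : t < n₀ * T := by
      have h1 : (t : ℕ∞) ≤ i j := by rw [← ht]; exact le_self_add
      rw [Nat.cast_le] at h1
      have h2 := hanti (Nat.zero_le j)
      have h3 := Nat.le_mul_of_pos_left T h₀.pos
      omega
    rw [coeff_shift_truncation hFD, dvd_add_left, ← add_sum_erase _ _ (mem_range.2 htT),
      dvd_add_left] at hdvd
    · obtain ⟨c, hc, hpc⟩ := exists_choose_pow_eq (p := p) (N := t + n) (by have := h.pos; omega) hjt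
      rw [hc, Nat.cast_mul, ← mul_assoc, (isUnit_natCast hp hpc).dvd_mul_right, mul_assoc,
        (h₀.isUnit_coeffs h hT hA hB hct).dvd_mul_left, Nat.cast_pow,
        pow_dvd_iff_le_emultiplicity, emultiplicity_pow_mul_pow hB, Nat.cast_add t,
        add_right_comm (t : ℕ∞), ht] at hdvd
      norm_cast at hdvd
      omega
    · refine dvd_sum fun t' ht' => ?_
      rcases eq_or_ne (coeffs p n πA πB t') 0 with h4 | h4
      · rw [h4, map_zero, zero_mul, zero_mul]
        exact dvd_zero _
      · rw [add_assoc n]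
        refine hterm (p ^ j) t' _ (Nat.one_le_pow _ _ hpp.pos) ?_
        rw [padicValNat.prime_pow]
        exact hother t' (mem_erase.1 ht').1 h4
    · refine (pow_dvd_pow πB ?_).mul_right _
      have := hanti (Nat.zero_le j)
      omega

/-- The indices of inseparability describe the divisibility of the first coefficients of
`H (π (1 + u))`, for all uniformizers `π` and all admissible polynomials `H`. -/
theorem TotRam.le_idx_iff (h : TotRam A B n)
    (hT : ∀ a : A, ∃ t ∈ teichmullerReps p A, ¬ IsUnit (a - t)) (hp : ¬ IsUnit (p : B))
    (hA : Irreducible πA) (hB : Irreducible πB) {π : B} (hπ : Irreducible π) {H : A[X]} {α : A}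
    (hH : aeval π H = algebraMap A B α) (hlow : ∀ i < n, ¬ IsUnit (H.coeff i))
    (hu : IsUnit (H.coeff n)) {j : ℕ} (hj : j ≤ padicValNat p n) (y : ℕ) :
    y ≤ idx p n πA πB j ↔ ∀ k, 1 ≤ k → k ≤ p ^ j →
      π ^ (n + y) ∣ (shift π (H.map (algebraMap A B))).coeff k := by
  have hpp : p.Prime := Fact.out
  have hfin := h.index_zero_ne_top hT hp hA hB
  have hanti := idx_antitone (h.coeffs_zero_ne_zero h hT hA hB) hfin
  obtain ⟨F, hF, hFlow, hFu, hFd, hFs⟩ := h.exists_good_polynomial h hT hp hA hB hfin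
  have hass : ∀ k, Associated (π ^ k) (πB ^ k) := fun k =>
    (IsDiscreteValuationRing.associated_of_irreducible B hπ hB).pow_pow
  refine ⟨fun hy k hk1 hk => ?_, fun hd => ?_⟩
  · refine h.dvd_coeff_shift hπ hB hH hF hu hFu hFlow (N := p ^ j) ?_ hk1 hk
    intro k hk1 hk
    refine (hass _).dvd.trans ((pow_dvd_pow πB ?_).trans (hFd k hk1))
    have := hanti (padicValNat_le_of_le_pow (p := p) hk1 hk)
    omega
  · by_contra! hlt
    -- Exact valuations are known only where the sequence drops, so `j` is replaced by the first
    -- `j'` with the same index.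
    have hex : ∃ j', idx p n πA πB j' = idx p n πA πB j := ⟨j, rfl⟩
    classical
    set j' := Nat.find hex with hj'
    have h1 : idx p n πA πB j' = idx p n πA πB j := Nat.find_spec hex
    have h2 : j' ≤ j := Nat.find_min' hex rfl
    refine hFs j' (h2.trans hj) (fun j'' hj'' => ?_) ?_
    · exact lt_of_le_of_ne (hanti hj''.le) fun h3 => Nat.find_min hex hj'' (h3.symm.trans h1)
    · refine (pow_dvd_pow πB ?_).trans ((hass (n + y)).symm.dvd.trans
        (h.dvd_coeff_shift hB hπ hF hH hFu hu hlow (N := p ^ j) hd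
          (Nat.one_le_pow _ _ hpp.pos) (Nat.pow_le_pow_right hpp.pos h2)))
      omega

theorem TotRam.idx_eq (h : TotRam A B n)
    (hT : ∀ a : A, ∃ t ∈ teichmullerReps p A, ¬ IsUnit (a - t)) (hp : ¬ IsUnit (p : B))
    {πA' : A} {πB' : B}
    (hA : Irreducible πA) (hB : Irreducible πB) (hA' : Irreducible πA') (hB' : Irreducible πB') :
    idx p n πA πB = idx p n πA' πB' := by
  ext j
  rcases le_or_gt j (padicValNat p n) with hj | hj
  · obtain ⟨F, hF, hlow, hu, -, -⟩ := h.exists_good_polynomial h hT hp hA hB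
      (h.index_zero_ne_top hT hp hA hB)
    exact eq_of_forall_le_iff fun y => (h.le_idx_iff hT hp hA hB hB hF hlow hu hj y).trans
      (h.le_idx_iff hT hp hA' hB' hB hF hlow hu hj y).symm
  · rw [idx_of_lt hj, idx_of_lt hj]

end GoodPolynomial

/-! ### Weights of polynomials and of their `p`-power powers -/

section Weight

variable {R : Type*} [CommRing R]

/-- The coefficients of `P` up to degree `N` have weight at least `θ`, if `π` has weight `1` and the
variable has weight `x`. -/
def WeightGE (π : R) (x : ℝ) (N : ℕ) (θ : ℝ) (P : R[X]) : Prop :=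
  ∀ k ≤ N, π ^ ⌈θ - k * x⌉₊ ∣ P.coeff k

namespace WeightGE

variable {π : R} {x : ℝ} {N : ℕ} {θ θ' : ℝ} {P Q : R[X]}

theorem mono (h : WeightGE π x N θ P) (hθ : θ' ≤ θ) : WeightGE π x N θ' P := fun k hk =>
  (pow_dvd_pow π (Nat.ceil_le_ceil (by linarith))).trans (h k hk)

theorem add (h : WeightGE π x N θ P) (h' : WeightGE π x N θ Q) : WeightGE π x N θ (P + Q) :=
  fun k hk => by rw [coeff_add]; exact dvd_add (h k hk) (h' k hk)

theorem sum {ι : Type*} {s : Finset ι} {f : ι → R[X]} (h : ∀ i ∈ s, WeightGE π x N θ (f i)) :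
    WeightGE π x N θ (∑ i ∈ s, f i) := fun k hk => by
  rw [finsetSum_coeff]
  exact dvd_sum fun i hi => h i hi k hk

theorem mul (h : WeightGE π x N θ P) (h' : WeightGE π x N θ' Q) :
    WeightGE π x N (θ + θ') (P * Q) := fun k hk => by
  rw [coeff_mul]
  refine dvd_sum fun ij hij => ?_
  rw [HasAntidiagonal.mem_antidiagonal] at hij
  refine dvd_trans ?_ (mul_dvd_mul (h ij.1 (by omega)) (h' ij.2 (by omega)))
  rw [← pow_add]
  refine pow_dvd_pow π ((Nat.ceil_le_ceil ?_).trans (Nat.ceil_add_le _ _))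
  rw [← hij]
  push_cast
  linarith

theorem of_nonpos (hx : 0 ≤ x) (hθ : θ ≤ 0) : WeightGE π x N θ P := fun k _ => by
  rw [Nat.ceil_eq_zero.2 (by have := mul_nonneg k.cast_nonneg hx; linarith), pow_zero]
  exact one_dvd _

theorem pow (hx : 0 ≤ x) (h : WeightGE π x N θ P) (k : ℕ) : WeightGE π x N (k * θ) (P ^ k) := by
  induction k with
  | zero => exact of_nonpos hx (by simp)
  | succ k ih =>
    rw [pow_succ]
    refine (ih.mul h).mono (le_of_eq ?_)
    push_cast
    ring

theorem C_mul (hx : 0 ≤ x) {c : R} {a : ℕ} (hc : π ^ a ∣ c) (h : WeightGE π x N θ P) :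
    WeightGE π x N (a + θ) (C c * P) := by
  refine mul (fun k _ => ?_) h
  rw [coeff_C]
  split_ifs with hk
  · refine (pow_dvd_pow π (Nat.ceil_le.2 ?_)).trans hc
    have := mul_nonneg k.cast_nonneg hx
    linarith
  · exact dvd_zero _

theorem pow_dvd_coeff (h : WeightGE π x N θ P) {k a : ℕ} (hk : k ≤ N) (ha : (a : ℝ) < θ - k * x + 1) :
    π ^ a ∣ P.coeff k := by
  refine (pow_dvd_pow π ?_).trans (h k hk)
  have h1 := Nat.le_ceil (θ - k * x)
  have h2 : (a : ℝ) < (⌈θ - k * x⌉₊ : ℕ) + 1 := by linarith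
  have h3 : a < ⌈θ - k * x⌉₊ + 1 := by exact_mod_cast h2
  omega

variable {p : ℕ} [Fact p.Prime] {e : ℕ}

/-- The weight of a `p`-th power, and the coefficient in degree `p * M` up to terms of
higher weight. -/
theorem pow_prime (hx : 0 ≤ x) (he : π ^ e ∣ (p : R)) {M : ℕ} (h₀ : WeightGE π x M θ P)
    (h₁ : WeightGE π x (p * M) θ' P) (hθ' : 0 ≤ θ') :
    WeightGE π x (p * M) (min (p * θ) (e + θ')) (P ^ p) ∧
      π ^ ⌈e + 2 * θ' - (p * M : ℕ) * x⌉₊ ∣ (P ^ p).coeff (p * M) - P.coeff M ^ p := by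
  rcases subsingleton_or_nontrivial R with hR | hR
  · exact ⟨fun k _ => ⟨0, Subsingleton.elim _ _⟩, 0, Subsingleton.elim _ _⟩
  have hp : p.Prime := Fact.out
  -- `P` is cut at degree `M`. In degrees up to `p * M`, `S ^ p` contributes nothing, `P' ^ p` has
  -- weight `p * θ` and top coefficient `P.coeff M ^ p`, and the mixed terms contain `p * P' * S`,
  -- of weight `e + 2 * θ'`.
  set P' := P %ₘ (X ^ (M + 1)) with hP'
  set S := X ^ (M + 1) * (P /ₘ X ^ (M + 1)) with hS
  have hPS : P' + S = P := modByMonic_add_div P (X ^ (M + 1))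
  have hdeg : P'.natDegree ≤ M := by
    have h1 : (X ^ (M + 1) : R[X]) ≠ 1 := fun h => by simpa using congrArg natDegree h
    have h2 : P'.natDegree < _ := natDegree_modByMonic_lt P (monic_X_pow (R := R) (M + 1)) h1
    rw [natDegree_X_pow] at h2
    omega
  have hSlow : ∀ k ≤ M, S.coeff k = 0 := fun k hk => by
    rw [hS, coeff_X_pow_mul', if_neg (by omega)]
  have hP'low : ∀ k ≤ M, P'.coeff k = P.coeff k := fun k hk => by
    rw [← hPS, coeff_add, hSlow k hk, add_zero]
  have hP'high : ∀ k, M < k → P'.coeff k = 0 := fun k hk =>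
    coeff_eq_zero_of_natDegree_lt (by omega)
  have hShigh : ∀ k, M < k → S.coeff k = P.coeff k := fun k hk => by
    rw [← hPS, coeff_add, hP'high k hk, zero_add]
  have w₀ : WeightGE π x (p * M) θ P' := fun k _ => by
    rcases le_or_gt k M with hk | hk
    · rw [hP'low k hk]; exact h₀ k hk
    · rw [hP'high k hk]; exact dvd_zero _
  have w₁ : WeightGE π x (p * M) θ' P' := fun k hk' => by
    rcases le_or_gt k M with hk | hk
    · rw [hP'low k hk]; exact h₁ k hk'
    · rw [hP'high k hk]; exact dvd_zero _
  have w₂ : WeightGE π x (p * M) θ' S := fun k hk' => by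
    rcases le_or_gt k M with hk | hk
    · rw [hSlow k hk]; exact dvd_zero _
    · rw [hShigh k hk]; exact h₁ k hk'
  have hSp : ∀ k ≤ p * M, (S ^ p).coeff k = 0 := fun k hk => by
    rw [hS, mul_pow, ← pow_mul, coeff_X_pow_mul', if_neg]
    have := hp.pos
    nlinarith
  obtain ⟨r, hr⟩ := exists_add_pow_prime_eq hp P' S
  rw [hPS] at hr
  have wr : WeightGE π x (p * M) (e + 2 * θ') ((p : R[X]) * P' * S * r) := by
    have := ((w₁.mul w₂).mul (of_nonpos (P := r) hx le_rfl)).C_mul hx he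
    rw [C_eq_natCast, ← mul_assoc, ← mul_assoc] at this
    exact this.mono (by linarith)
  refine ⟨?_, ?_⟩
  · rw [hr]
    refine ((w₀.pow hx p).mono (min_le_left _ _)).add ?_ |>.add
      (wr.mono ((min_le_right _ _).trans (by linarith)))
    intro k hk
    rw [hSp k hk]
    exact dvd_zero _
  · rw [hr, coeff_add, coeff_add, hSp _ le_rfl, add_zero, coeff_pow_of_natDegree_le hdeg,
      hP'low M le_rfl, add_sub_cancel_left]
    exact wr _ le_rfl

end WeightGE

/-- The weight of a `p ^ t`-th power in degrees up to `p ^ b`. -/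
def powWeight (p e : ℕ) (θ : ℕ → ℝ) : ℕ → ℕ → ℝ
  | 0, b => θ b
  | t + 1, 0 => e + powWeight p e θ t 0
  | t + 1, b + 1 => min (p * powWeight p e θ t b) (e + powWeight p e θ t (b + 1))

/-- Each of the `t` steps either multiplies by `p` and lowers `b`, or adds `e`; `t'` counts the
steps of the first kind. Factors `p` falling on copies of `e` are discarded. -/
theorem le_powWeight {p e : ℕ} (hp : 1 ≤ p) {θ : ℕ → ℝ} (t : ℕ) : ∀ (b : ℕ) (y : ℝ),
    (∀ t' ≤ t, t' ≤ b → y ≤ (t - t' : ℕ) * e + (p : ℝ) ^ t' * θ (b - t')) →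
    y ≤ powWeight p e θ t b := by
  have hp' : (1 : ℝ) ≤ p := by exact_mod_cast hp
  induction t with
  | zero => intro b y h; simpa [powWeight] using h 0 le_rfl (Nat.zero_le b)
  | succ t ih =>
    have step : ∀ b y, (∀ t' ≤ t + 1, t' ≤ b →
        y ≤ (t + 1 - t' : ℕ) * e + (p : ℝ) ^ t' * θ (b - t')) →
        y ≤ e + powWeight p e θ t b := by
      intro b y h
      have := ih b (y - e) fun t' ht' hb => by
        have := h t' (by omega) hb
        rw [show t + 1 - t' = (t - t') + 1 by omega] at this
        push_cast at this
        linarith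
      linarith
    intro b y h
    cases b with
    | zero => exact step 0 y h
    | succ b =>
      refine le_min ?_ (step (b + 1) y h)
      rw [mul_comm, ← div_le_iff₀ (by linarith)]
      refine ih b _ fun t' ht' hb => ?_
      rw [div_le_iff₀ (by linarith)]
      have h1 := h (t' + 1) (by omega) (by omega)
      rw [show t + 1 - (t' + 1) = t - t' by omega, show b + 1 - (t' + 1) = b - t' by omega,
        pow_succ] at h1
      have h2 : (0 : ℝ) ≤ (t - t' : ℕ) * e := by positivity
      nlinarith

theorem powWeight_nonneg {p e : ℕ} (hp : 1 ≤ p) {θ : ℕ → ℝ} (hθ : ∀ b, 0 ≤ θ b) (t b : ℕ) :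
    0 ≤ powWeight p e θ t b :=
  le_powWeight hp t b 0 fun t' _ _ => by have := hθ (b - t'); positivity

variable {p : ℕ} [Fact p.Prime] {π : R} {x : ℝ} {e : ℕ} {θ : ℕ → ℝ} {w : R[X]}

theorem weightGE_pow_prime_pow (hx : 0 ≤ x) (he : π ^ e ∣ (p : R)) (hθ : ∀ b, 0 ≤ θ b)
    (hw0 : w.coeff 0 = 0) (hw : ∀ b, WeightGE π x (p ^ b) (θ b) w) (t : ℕ) :
    ∀ b, WeightGE π x (p ^ b) (powWeight p e θ t b) (w ^ p ^ t) := by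
  have hp : p.Prime := Fact.out
  induction t with
  | zero => simpa [powWeight] using hw
  | succ t ih =>
    intro b
    cases b with
    | zero =>
      intro k hk
      rw [coeff_pow_eq_zero hw0 (hk.trans_lt ?_)]
      · exact dvd_zero _
      · rw [pow_zero]
        exact Nat.one_lt_pow (by omega) hp.one_lt
    | succ b =>
      rw [pow_succ p t, pow_mul, pow_succ' p b]
      refine (WeightGE.pow_prime hx he (ih b) ?_ (powWeight_nonneg hp.one_le hθ t (b + 1))).1
      rw [← pow_succ']
      exact ih (b + 1)

/-- Up to terms of higher weight, the coefficient of `w ^ p ^ s` in degree `p ^ (c + s)` is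
the `p ^ s`-th power of the coefficient of `w` in degree `p ^ c`. -/
theorem dvd_coeff_pow_prime_pow_sub (hx : 0 ≤ x) (he : π ^ e ∣ (p : R)) (hθ : ∀ b, 0 ≤ θ b)
    (hanti : Antitone θ) (hw0 : w.coeff 0 = 0) (hw : ∀ b, WeightGE π x (p ^ b) (θ b) w)
    (c s : ℕ) : ∀ y : ℝ,
    (∀ t < s, y ≤ (s - t : ℕ) * e + 2 * ((p : ℝ) ^ t * θ (c + s - t))) →
      π ^ ⌈y - (p ^ (c + s) : ℕ) * x⌉₊ ∣
        (w ^ p ^ s).coeff (p ^ (c + s)) - w.coeff (p ^ c) ^ p ^ s := by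
  have hp : p.Prime := Fact.out
  have hp1 : (2 : ℝ) ≤ p := by exact_mod_cast hp.two_le
  induction s with
  | zero => intro y _; simp
  | succ s ih =>
    intro y hy
    set b := c + s with hb
    have hT := weightGE_pow_prime_pow hx he hθ hw0 hw s
    have h1 := (WeightGE.pow_prime hx he (hT b)
      (by rw [← pow_succ']; exact hT (b + 1)) (powWeight_nonneg hp.one_le hθ s (b + 1))).2
    have hy' : ∀ t ≤ s, y - e ≤ 2 * ((s - t : ℕ) * e + (p : ℝ) ^ t * θ (b + 1 - t)) := by
      intro t ht
      have := hy t (by omega)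
      rw [show s + 1 - t = (s - t) + 1 by omega, show c + (s + 1) - t = b + 1 - t by omega] at this
      have h2 : (0 : ℝ) ≤ (s - t : ℕ) * e := by positivity
      push_cast at this
      linarith
    have hy'' : ∀ t ≤ s, y - e ≤ 2 * ((s - t : ℕ) * e + (p : ℝ) ^ t * θ (b - t)) := by
      intro t ht
      refine (hy' t ht).trans ?_
      have := hanti (show b - t ≤ b + 1 - t by omega)
      gcongr
    have h2 : (y - e) / 2 ≤ powWeight p e θ s (b + 1) :=
      le_powWeight hp.one_le _ _ _ fun t ht _ => by have := hy' t ht; linarith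
    rw [show c + (s + 1) = b + 1 by omega, pow_succ p s, pow_mul w, pow_mul (w.coeff _),
      pow_succ' p b]
    -- The error is that of the last `p`-th power, whose mixed terms have two factors of `w` (whence
    -- the `2` in the hypothesis), plus the effect of the earlier error `δ`, namely `δ ^ p` and a
    -- multiple of `p * δ * w.coeff (p ^ c) ^ p ^ s`.
    rw [← sub_add_sub_cancel _ ((w ^ p ^ s).coeff (p ^ b) ^ p)]
    refine dvd_add ((pow_dvd_pow π (Nat.ceil_le_ceil (by linarith))).trans h1) ?_
    set δ := (w ^ p ^ s).coeff (p ^ b) - w.coeff (p ^ c) ^ p ^ s with hδ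
    obtain ⟨r, hr⟩ := exists_add_pow_prime_eq hp δ (w.coeff (p ^ c) ^ p ^ s)
    rw [hδ, sub_add_cancel, ← hδ] at hr
    rw [show (w ^ p ^ s).coeff (p ^ b) ^ p - (w.coeff (p ^ c) ^ p ^ s) ^ p =
      δ ^ p + p * (w.coeff (p ^ c) ^ p ^ s * δ) * r by rw [hr]; ring]
    refine dvd_add ?_ (Dvd.dvd.mul_right ?_ _)
    · have h3 := ih (y / p) fun t ht => by
        have h4 := hy (t + 1) (by omega)
        rw [show s + 1 - (t + 1) = s - t by omega, show c + (s + 1) - (t + 1) = b - t by omega,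
          pow_succ] at h4
        rw [div_le_iff₀ (by linarith)]
        have h5 : (0 : ℝ) ≤ (s - t : ℕ) * e := by positivity
        nlinarith
      refine dvd_trans ?_ (pow_dvd_pow_of_dvd h3 p)
      rw [← pow_mul]
      refine pow_dvd_pow π (Nat.ceil_le.2 ?_)
      have h6 := Nat.le_ceil (y / p - (p ^ b : ℕ) * x)
      rw [sub_le_iff_le_add, div_le_iff₀ (by linarith)] at h6
      push_cast at h6 ⊢
      linarith
    · have h3 := ih ((y - e) / 2) fun t ht => by
        have h4 := hy'' t ht.le
        have := hθ (b - t)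
        have h5 : (0 : ℝ) ≤ (s - t : ℕ) * e := by positivity
        have h6 : 0 ≤ (p : ℝ) ^ t * θ (b - t) := by positivity
        linarith
      have h4 := pow_dvd_pow_of_dvd (hw c (p ^ c) le_rfl) (p ^ s)
      rw [← pow_mul] at h4
      refine dvd_trans ?_ (mul_dvd_mul he (mul_dvd_mul h4 h3))
      rw [← pow_add, ← pow_add]
      refine pow_dvd_pow π (Nat.ceil_le.2 ?_)
      have h5 := Nat.le_ceil ((y - e) / 2 - (p ^ b : ℕ) * x)
      have h6 := Nat.le_ceil (θ c - (p ^ c : ℕ) * x)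
      have h7 : (y - e) / 2 ≤ (p : ℝ) ^ s * θ c := by
        have := hy'' s le_rfl
        rw [show b - s = c by omega] at this
        simp only [tsub_self, Nat.cast_zero, zero_mul, zero_add] at this
        linarith
      have h8 : (p : ℝ) ^ s * (θ c - (p ^ c : ℕ) * x) ≤
          (p : ℝ) ^ s * (⌈θ c - (p ^ c : ℕ) * x⌉₊ : ℕ) := by gcongr
      have h9 : 0 ≤ ((p : ℝ) - 2) * ((p : ℝ) ^ b * x) :=
        mul_nonneg (by linarith) (by positivity)
      have h10 : (p : ℝ) ^ b * x = (p : ℝ) ^ s * ((p : ℝ) ^ c * x) := by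
        rw [hb, pow_add]
        ring
      push_cast at h5 h8 ⊢
      linarith

end Weight

/-! ### Minimal pairs of indices -/

section Combinatorics

variable {i i' : ℕ → ℕ} {ν μ m p : ℕ} {x lam : ℝ}

/-- `m i_j + p ^ j (i'_k + p ^ k x)`. -/
noncomputable def pairVal (p m : ℕ) (i i' : ℕ → ℕ) (x : ℝ) (j k : ℕ) : ℝ :=
  m * i j + (p : ℝ) ^ j * (i' k + (p : ℝ) ^ k * x)

/-- The indices vanish beyond `ν` and `μ`, so moving a pair back into the rectangle only lowers
powers of `p`. -/
theorem pairVal_add_le (hx : 0 ≤ x) (hp : 1 < p) {ν : ℕ} (hi : ∀ j, ν ≤ j → i j = 0)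
    (hi' : ∀ k, μ ≤ k → i' k = 0) (j k : ℕ) :
    pairVal p m i i' x (min j ν) (min k μ) ≤ pairVal p m i i' x j k := by
  have hp' : (1 : ℝ) ≤ p := by exact_mod_cast hp.le
  have h1 : i (min j ν) = i j := by
    rcases le_total j ν with h | h
    · rw [min_eq_left h]
    · rw [min_eq_right h, hi _ h, hi _ le_rfl]
  have h2 : i' (min k μ) = i' k := by
    rcases le_total k μ with h | h
    · rw [min_eq_left h]
    · rw [min_eq_right h, hi' _ h, hi' _ le_rfl]
  rw [pairVal, pairVal, h1, h2]
  gcongr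
  · exact min_le_left _ _
  · exact min_le_left _ _

theorem le_pairVal (hx : 0 ≤ x) (hp : 1 < p) (hi : ∀ j, ν ≤ j → i j = 0)
    (hi' : ∀ k, μ ≤ k → i' k = 0) {l : ℕ}
    (hlam : ∀ j ≤ ν, ∀ k ≤ μ, j + k ≤ l → lam ≤ pairVal p m i i' x j k) {j k : ℕ}
    (hjk : j + k ≤ l) : lam ≤ pairVal p m i i' x j k := by
  refine (hlam _ (min_le_right j ν) _ (min_le_right k μ) ?_).trans
    (pairVal_add_le hx hp hi hi' j k)
  have := min_le_left j ν
  have := min_le_left k μ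
  omega

/-- If some level contains exactly one minimal pair, then some level contains exactly one minimal
pair at which, moreover, both sequences of indices drop. -/
theorem exists_strict_pair (hx : 0 ≤ x) (hp : 1 < p) (hm : 0 < m) (hanti : Antitone i)
    (hanti' : Antitone i') (hi : ∀ j, i j = 0 ↔ ν ≤ j) (hi' : ∀ k, i' k = 0 ↔ μ ≤ k) {l : ℕ}
    (hlam : ∀ j ≤ ν, ∀ k ≤ μ, j + k ≤ l → lam ≤ pairVal p m i i' x j k)
    (hex : ∃ j k, j ≤ ν ∧ k ≤ μ ∧ j + k ≤ l ∧ pairVal p m i i' x j k = lam ∧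
      ∀ s ≤ ν, ∀ r ≤ μ, s + r = j + k → pairVal p m i i' x s r = lam → s = j) :
    ∃ j k, j ≤ ν ∧ k ≤ μ ∧ j + k ≤ l ∧ pairVal p m i i' x j k = lam ∧
      (∀ j' < j, i j < i j') ∧ (∀ k' < k, i' k < i' k') ∧
      ∀ t ≤ j + k, t ≠ j → lam < pairVal p m i i' x t (j + k - t) := by
  have hp0 : (0 : ℝ) < p := by exact_mod_cast hp.le
  have hp1 : (1 : ℝ) < p := by exact_mod_cast hp
  have hm' : (0 : ℝ) < m := by exact_mod_cast hm
  -- The level is chosen least. If a sequence did not drop at the chosen pair, lowering that index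
  -- by one would give a value below `lam`, or, when `x = 0`, a unique minimal pair on a lower
  -- level.
  have hmin : ∃ b j k, j + k = b ∧ j ≤ ν ∧ k ≤ μ ∧ j + k ≤ l ∧ pairVal p m i i' x j k = lam ∧
      ∀ s ≤ ν, ∀ r ≤ μ, s + r = j + k → pairVal p m i i' x s r = lam → s = j := by
    obtain ⟨j, k, h⟩ := hex
    exact ⟨j + k, j, k, rfl, h⟩
  classical
  obtain ⟨j, k, hb, hj, hk, hjk, hval, huniq⟩ := Nat.find_spec hmin
  have hleast : ∀ j' k', j' + k' < j + k → j' ≤ ν → k' ≤ μ → pairVal p m i i' x j' k' = lam →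
      (∀ s ≤ ν, ∀ r ≤ μ, s + r = j' + k' → pairVal p m i i' x s r = lam → s = j') → False := by
    intro j' k' hlt h1 h2 h3 h4
    exact Nat.find_min hmin (hb ▸ hlt) ⟨j', k', rfl, h1, h2, by omega, h3, h4⟩
  have hle : ∀ j' ≤ ν, ∀ k' ≤ μ, j' + k' ≤ l → pairVal p m i i' x j' k' ≤ lam →
      pairVal p m i i' x j' k' = lam := fun j' h1 k' h2 h3 h4 => le_antisymm h4 (hlam _ h1 _ h2 h3)
  have hiμ : i' μ = 0 := (hi' μ).2 le_rfl
  have hstrictk : ∀ k' < k, i' k < i' k' := by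
    intro k' hk'
    by_contra! hcon
    have hkk : i' (k - 1) = i' k :=
      le_antisymm ((hanti' (by omega : k' ≤ k - 1)).trans hcon) (hanti' (by omega))
    rcases hx.lt_or_eq with hx | rfl
    · have h1 : pairVal p m i i' x j (k - 1) < lam := by
        rw [← hval, pairVal, pairVal, hkk]
        gcongr
        omega
      exact absurd (hlam j hj (k - 1) (by omega) (by omega)) (not_le.2 h1)
    · have h1 : pairVal p m i i' 0 j (k - 1) = lam := by
        rw [← hval, pairVal, pairVal, hkk]
        simp
      refine hleast j (k - 1) (by omega) hj (by omega) h1 fun s hs r hr hsr hv => ?_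
      rcases hr.lt_or_eq with hr | rfl
      · refine huniq s hs (r + 1) hr (by omega) (hle _ hs _ hr (by omega) ?_)
        rw [← hv, pairVal, pairVal]
        simp only [mul_zero, add_zero]
        gcongr
        exact hanti' (Nat.le_succ r)
      · have h2 : s + 1 = j := by
          refine huniq (s + 1) (by omega) r le_rfl (by omega) (hle _ (by omega) _ le_rfl (by omega) ?_)
          rw [← hv, pairVal, pairVal, hiμ]
          simp only [mul_zero, add_zero, Nat.cast_zero]
          gcongr
          exact hanti (Nat.le_succ s)
        have h3 : i' (k - 1) = 0 := by rw [hkk, hi']; omega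
        rw [hi'] at h3
        omega
  have hstrictj : ∀ j' < j, i j < i j' := by
    intro j' hj'
    by_contra! hcon
    have hjj : i (j - 1) = i j :=
      le_antisymm ((hanti (by omega : j' ≤ j - 1)).trans hcon) (hanti (by omega))
    have hpj : (p : ℝ) ^ (j - 1) < (p : ℝ) ^ j := pow_lt_pow_right₀ hp1 (by omega)
    have hge := hlam (j - 1) (by omega) k hk (by omega)
    rw [← hval, pairVal, pairVal, hjj] at hge
    have hφ : (i' k : ℝ) + (p : ℝ) ^ k * x ≤ 0 := by
      by_contra! hpos
      have := mul_lt_mul_of_pos_right hpj hpos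
      linarith
    have h1 : 0 ≤ (p : ℝ) ^ k * x := by positivity
    have h2 : (0 : ℝ) ≤ i' k := Nat.cast_nonneg _
    have h3 : i' k = 0 := by exact_mod_cast (by linarith : (i' k : ℝ) = 0)
    obtain rfl : x = 0 := by
      have h4 : (p : ℝ) ^ k * x = 0 := by linarith
      exact (mul_eq_zero.1 h4).resolve_left (by positivity)
    obtain rfl : k = μ := le_antisymm hk ((hi' k).1 h3)
    refine hleast (j - 1) k (by omega) (by omega) hk ?_ fun s hs r hr hsr hv => ?_
    · rw [← hval, pairVal, pairVal, hjj, h3]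
      simp
    · by_contra hne
      have h5 : s = j := by
        refine huniq s hs (r + 1) (by omega) (by omega) (hle _ hs _ (by omega) (by omega) ?_)
        rw [← hv, pairVal, pairVal]
        simp only [mul_zero, add_zero]
        gcongr
        exact hanti' (Nat.le_succ r)
      subst h5
      rw [← hval, pairVal, pairVal, h3] at hv
      simp only [mul_zero, add_zero, Nat.cast_zero, add_eq_left, mul_eq_zero, Nat.cast_eq_zero] at hv
      have h6 := hv.resolve_left (by positivity)
      rw [hi'] at h6
      omega
  refine ⟨j, k, hj, hk, hjk, hval, hstrictj, hstrictk, fun t ht hne => ?_⟩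
  -- Ties outside the rectangle need separate exclusion: moving back inside would give a value below
  -- `lam`, except in degenerate cases with `x = 0`, ruled out by uniqueness on the level, the drop
  -- of `i` and the position of the zeros of `i'`.
  have hge := le_pairVal hx hp (fun j => (hi j).2) (fun k => (hi' k).2) hlam
    (show t + (j + k - t) ≤ l by omega)
  refine lt_of_le_of_ne hge fun heq => ?_
  rcases le_or_gt t ν with htν | htν
  · rcases le_or_gt (j + k - t) μ with hr | hr
    · exact hne (huniq t htν _ hr (by omega) heq.symm)
    · have h1 := hlam t htν μ le_rfl (by omega)
      rw [heq, pairVal, pairVal, (hi' _).2 hr.le, hiμ] at h1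
      have h2 : (p : ℝ) ^ μ < (p : ℝ) ^ (j + k - t) := pow_lt_pow_right₀ hp1 hr
      have h3 : (0 : ℝ) < (p : ℝ) ^ t := by positivity
      rcases hx.lt_or_eq with hx | rfl
      · have := mul_lt_mul_of_pos_left (mul_lt_mul_of_pos_right h2 hx) h3
        simp only [Nat.cast_zero, zero_add] at h1
        linarith
      · have h4 : j + k - μ = j := by
          refine huniq _ (by omega) μ le_rfl (by omega) (hle _ (by omega) _ le_rfl (by omega) ?_)
          rw [heq, pairVal, pairVal, (hi' _).2 hr.le, hiμ]
          simp only [mul_zero, add_zero, Nat.cast_zero]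
          gcongr
          exact hanti (by omega)
        obtain rfl : k = μ := by omega
        rw [← hval, pairVal, pairVal, (hi' _).2 hr.le, hiμ] at heq
        simp only [mul_zero, add_zero, Nat.cast_zero, mul_eq_mul_left_iff, Nat.cast_inj,
          Nat.cast_eq_zero, hm.ne', or_false] at heq
        have := hstrictj t (by omega)
        omega
  · have h1 := le_pairVal hx hp (fun j => (hi j).2) (fun k => (hi' k).2) hlam
      (show ν + (j + k - t) ≤ l by omega)
    rw [heq, pairVal, pairVal, (hi _).2 htν.le, (hi _).2 le_rfl] at h1
    have h2 : (p : ℝ) ^ ν < (p : ℝ) ^ t := pow_lt_pow_right₀ hp1 htν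
    have hφ : (i' (j + k - t) : ℝ) + (p : ℝ) ^ (j + k - t) * x ≤ 0 := by
      by_contra! hpos
      have := mul_lt_mul_of_pos_right h2 hpos
      linarith
    have h3 : 0 ≤ (p : ℝ) ^ (j + k - t) * x := by positivity
    have h4 : (0 : ℝ) ≤ i' (j + k - t) := Nat.cast_nonneg _
    have h5 : i' (j + k - t) = 0 := by exact_mod_cast (by linarith : (i' (j + k - t) : ℝ) = 0)
    rw [hi'] at h5
    omega

end Combinatorics

/-! ### Weight and dominant coefficient of `∑ d_k w ^ k` -/

section Composition

/-- `min {i_k + p ^ k x : k ≤ b}`. -/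
noncomputable def minWeight (p : ℕ) (i : ℕ → ℕ) (x : ℝ) (b : ℕ) : ℝ :=
  (range (b + 1)).inf' nonempty_range_add_one fun k => (i k : ℝ) + (p : ℝ) ^ k * x

theorem minWeight_le (p : ℕ) (i : ℕ → ℕ) (x : ℝ) {b k : ℕ} (hk : k ≤ b) :
    minWeight p i x b ≤ i k + (p : ℝ) ^ k * x :=
  inf'_le _ (mem_range.2 (Nat.lt_succ_of_le hk))

theorem exists_minWeight_eq (p : ℕ) (i : ℕ → ℕ) (x : ℝ) (b : ℕ) :
    ∃ k ≤ b, minWeight p i x b = i k + (p : ℝ) ^ k * x := by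
  obtain ⟨k, hk, h⟩ := exists_mem_eq_inf' (nonempty_range_add_one (n := b))
    fun k => (i k : ℝ) + (p : ℝ) ^ k * x
  exact ⟨k, Nat.lt_succ_iff.1 (mem_range.1 hk), h⟩

theorem minWeight_antitone (p : ℕ) (i : ℕ → ℕ) (x : ℝ) : Antitone (minWeight p i x) := by
  intro b b' hb
  obtain ⟨k, hk, h⟩ := exists_minWeight_eq p i x b
  rw [h]
  exact minWeight_le p i x (hk.trans hb)

theorem minWeight_nonneg (p : ℕ) (i : ℕ → ℕ) {x : ℝ} (hx : 0 ≤ x) (b : ℕ) :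
    0 ≤ minWeight p i x b := by
  obtain ⟨k, -, h⟩ := exists_minWeight_eq p i x b
  rw [h]
  positivity

variable {p : ℕ} [Fact p.Prime] {R : Type*} [CommRing R] {π : R} {x : ℝ} {e m D : ℕ}
  {i i' : ℕ → ℕ} {w : R[X]} {d : ℕ → R}

/-- The Hasse-Herbrand function enters here: the term of degree `k` has weight at least `i' (v_p(k))
+ k * x`, and `p ^ v_p(k) ≤ k`. -/
theorem weightGE_minWeight (hx : 0 ≤ x) (hw0 : w.coeff 0 = 0)
    (hw : ∀ k, 1 ≤ k → π ^ i' (padicValNat p k) ∣ w.coeff k) (b : ℕ) :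
    WeightGE π x (p ^ b) (minWeight p i' x b) w := by
  intro k hk
  rcases Nat.eq_zero_or_pos k with rfl | hk0
  · rw [hw0]
    exact dvd_zero _
  · refine (pow_dvd_pow π (Nat.ceil_le.2 ?_)).trans (hw k hk0)
    have h1 := minWeight_le p i' x (padicValNat_le_of_le_pow hk0 hk)
    have h2 : ((p ^ padicValNat p k : ℕ) : ℝ) ≤ k :=
      Nat.cast_le.2 (Nat.le_of_dvd hk0 pow_padicValNat_dvd)
    have h3 := mul_le_mul_of_nonneg_right h2 hx
    push_cast at h3
    linarith

theorem weightGE_term {θ : ℕ → ℝ} (hx : 0 ≤ x) (he : π ^ e ∣ (p : R)) (hw0 : w.coeff 0 = 0)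
    (hθ : ∀ b, 0 ≤ θ b) (hw : ∀ b, WeightGE π x (p ^ b) (θ b) w) {k : ℕ}
    {c : R} {a : ℕ} (hc : π ^ a ∣ c) (b : ℕ) :
    ∃ q, k = p ^ padicValNat p k * q ∧ WeightGE π x (p ^ b)
      (a + q * powWeight p e θ (padicValNat p k) b) (C c * w ^ k) := by
  obtain ⟨q, hq⟩ : p ^ padicValNat p k ∣ k := pow_padicValNat_dvd
  refine ⟨q, hq, ?_⟩
  conv_rhs => rw [hq, pow_mul]
  exact ((weightGE_pow_prime_pow hx he hθ hw0 hw _ b).pow hx q).C_mul hx hc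

/-- Lower bound for the weight of `∑ d_k w ^ k`. -/
theorem weightGE_composition (hx : 0 ≤ x) (he : π ^ e ∣ (p : R)) (hw0 : w.coeff 0 = 0)
    (hw : ∀ k, 1 ≤ k → π ^ i' (padicValNat p k) ∣ w.coeff k)
    (hd : ∀ k, 1 ≤ k → π ^ (D + m * i (padicValNat p k)) ∣ d k)
    (hie : ∀ t t', t' ≤ t → m * i t' ≤ m * i t + (t - t') * e) {l : ℕ} {y : ℝ}
    (hy : ∀ j k, j + k ≤ l → y ≤ pairVal p m i i' x j k) (K : ℕ) :
    WeightGE π x (p ^ l) (D + y) (∑ k ∈ Ico 1 K, C (d k) * w ^ k) := by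
  have hp : p.Prime := Fact.out
  have hθ := minWeight_nonneg p i' hx
  refine WeightGE.sum fun k hk => ?_
  have hk1 := (mem_Ico.1 hk).1
  obtain ⟨q, hq, h⟩ := weightGE_term hx he hw0 hθ (weightGE_minWeight hx hw0 hw) (hd k hk1) l
  refine h.mono ?_
  set t := padicValNat p k
  have hq1 : (1 : ℝ) ≤ q := by
    have : q ≠ 0 := by rintro rfl; omega
    exact_mod_cast Nat.one_le_iff_ne_zero.2 this
  -- Passing from `i t` to `i t'` costs at most `(t - t') * e`, which is what the `t - t'` steps
  -- gaining a factor `p` supply.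
  have h1 : y - m * i t ≤ powWeight p e (minWeight p i' x) t l := by
    refine le_powWeight hp.one_le _ _ _ fun t' ht' hl => ?_
    obtain ⟨r, hr, hr'⟩ := exists_minWeight_eq p i' x (l - t')
    have h2 := hy t' r (by omega)
    have h3 : (m : ℝ) * i t' ≤ m * i t + (t - t' : ℕ) * e := by exact_mod_cast hie t t' ht'
    rw [pairVal] at h2
    rw [hr']
    linarith
  have h2 := powWeight_nonneg (e := e) hp.one_le hθ t l
  have h3 : powWeight p e (minWeight p i' x) t l ≤ q * powWeight p e (minWeight p i' x) t l :=
    le_mul_of_one_le_left h2 hq1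
  push_cast
  linarith

/-- The exact divisibility of the coefficient of `∑ d_k w ^ k` in degree `p ^ (j + k)`, if in that
degree there is a unique dominant term. -/
theorem not_pow_dvd_coeff_composition [IsDomain R] (hπ : Prime π) (hx : 0 ≤ x)
    (he : π ^ e ∣ (p : R)) (hw0 : w.coeff 0 = 0)
    (hw : ∀ k, 1 ≤ k → π ^ i' (padicValNat p k) ∣ w.coeff k)
    (hd : ∀ k, 1 ≤ k → π ^ (D + m * i (padicValNat p k)) ∣ d k)
    (hie : ∀ t t', t' ≤ t → m * i t' ≤ m * i t + (t - t') * e) {j r : ℕ}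
    (hdj : ¬ π ^ (D + m * i j + 1) ∣ d (p ^ j)) (hwr : ¬ π ^ (i' r + 1) ∣ w.coeff (p ^ r))
    (hdom : ∀ t ≤ j + r, t ≠ j → pairVal p m i i' x j r < pairVal p m i i' x t (j + r - t))
    (hdom' : ∀ t ≤ j + r, pairVal p m i i' x j r <
      m * i t + 2 * ((p : ℝ) ^ t * minWeight p i' x (j + r - t))) {K : ℕ} (hK : p ^ j < K) :
    ¬ π ^ (D + m * i j + p ^ j * i' r + 1) ∣
      (∑ k ∈ Ico 1 K, C (d k) * w ^ k).coeff (p ^ (j + r)) := by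
  have hp : p.Prime := Fact.out
  set b := j + r with hb
  set lam := pairVal p m i i' x j r with hlam
  have hθ := minWeight_nonneg p i' hx
  have hwt := weightGE_minWeight (x := x) hx hw0 hw
  -- Any real `z` strictly above `lam` and at most all competing weights suffices: valuations are
  -- integers, so rounding up yields the extra `+ 1` in the exponent.
  obtain ⟨z, hz, hz₁, hz₂⟩ : ∃ z, lam < z ∧
      (∀ t ≤ b, t ≠ j → z ≤ pairVal p m i i' x t (b - t)) ∧
      (∀ t ≤ b, z ≤ m * i t + 2 * ((p : ℝ) ^ t * minWeight p i' x (b - t))) := by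
    refine ⟨(range (b + 1)).inf' nonempty_range_add_one fun t =>
      min (if t = j then lam + 1 else pairVal p m i i' x t (b - t))
        (m * i t + 2 * ((p : ℝ) ^ t * minWeight p i' x (b - t))), ?_, ?_, ?_⟩
    · rw [lt_inf'_iff]
      intro t ht
      have ht' := Nat.lt_succ_iff.1 (mem_range.1 ht)
      refine lt_min ?_ (hdom' t ht')
      split_ifs with h
      · linarith
      · exact hdom t ht' h
    · intro t ht hne
      refine (inf'_le _ (mem_range.2 (Nat.lt_succ_of_le ht))).trans ((min_le_left _ _).trans ?_)
      rw [if_neg hne]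
    · intro t ht
      exact (inf'_le _ (mem_range.2 (Nat.lt_succ_of_le ht))).trans (min_le_right _ _)
  have hE : ((D + m * i j + p ^ j * i' r + 1 : ℕ) : ℝ) < D + z - (p ^ b : ℕ) * x + 1 := by
    rw [hlam, pairVal] at hz
    rw [hb]
    push_cast
    rw [pow_add]
    linarith
  have hother : ∀ k, 1 ≤ k → k ≠ p ^ j →
      π ^ (D + m * i j + p ^ j * i' r + 1) ∣ (C (d k) * w ^ k).coeff (p ^ b) := by
    intro k hk hkj
    rcases lt_or_ge (p ^ b) k with hbk | hbk
    · rw [coeff_C_mul, coeff_pow_eq_zero hw0 hbk, mul_zero]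
      exact dvd_zero _
    have htb := padicValNat_le_of_le_pow hk hbk
    obtain ⟨q, hq, h⟩ := weightGE_term hx he hw0 hθ hwt (hd k hk) b
    set t := padicValNat p k with ht
    have hq0 : q ≠ 0 := by rintro rfl; omega
    -- For `k = p ^ t` the coefficient is `d k * w.coeff (p ^ (b - t)) ^ k`, beaten by `hdom`, plus
    -- an error controlled by `hdom'`. For other `k`, `w ^ k` contains the square of `w ^ p ^ t`, so
    -- `hdom'` covers the whole term.
    rcases (show q = 1 ∨ 2 ≤ q by omega) with rfl | hq2
    · rw [mul_one] at hq
      have htj : t ≠ j := fun h => hkj (by rw [hq, h])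
      have h1 := dvd_coeff_pow_prime_pow_sub hx he hθ (minWeight_antitone p i' x) hw0 hwt
        (b - t) t (z - m * i t) fun t' ht' => by
          have h2 := hz₂ t' (by omega)
          have h3 : (m : ℝ) * i t' ≤ m * i t + (t - t' : ℕ) * e := by
            exact_mod_cast hie t t' ht'.le
          rw [show b - t + t = b by omega]
          linarith
      rw [show b - t + t = b by omega, ← hq] at h1
      rw [coeff_C_mul, ← sub_add_cancel ((w ^ k).coeff (p ^ b)) (w.coeff (p ^ (b - t)) ^ k),
        mul_add]
      refine dvd_add ?_ ?_
      · refine dvd_trans ?_ (mul_dvd_mul (hd k hk) h1)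
        rw [← pow_add, ← ht]
        refine pow_dvd_pow π ?_
        have h4 := Nat.le_ceil (z - m * i t - (p ^ b : ℕ) * x)
        have h5 : ((D + m * i j + p ^ j * i' r + 1 : ℕ) : ℝ) <
            (D + m * i t + ⌈z - m * i t - (p ^ b : ℕ) * x⌉₊ : ℕ) + 1 := by
          refine hE.trans_le ?_
          push_cast at h4 ⊢
          linarith
        have h6 : D + m * i j + p ^ j * i' r + 1 <
            D + m * i t + ⌈z - m * i t - (p ^ b : ℕ) * x⌉₊ + 1 := by exact_mod_cast h5
        exact Nat.lt_succ_iff.1 h6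
      · have h2 := hw (p ^ (b - t)) (Nat.one_le_pow _ _ hp.pos)
        rw [padicValNat.prime_pow] at h2
        have h3 := mul_dvd_mul (hd k hk) (pow_dvd_pow_of_dvd h2 k)
        rw [← pow_mul, ← pow_add, ← ht] at h3
        refine (pow_dvd_pow π ?_).trans h3
        have h4 := hdom t htb htj
        rw [hlam, pairVal, pairVal] at h4
        have h5 : (p : ℝ) ^ j * (p : ℝ) ^ r = (p : ℝ) ^ t * (p : ℝ) ^ (b - t) := by
          rw [← pow_add, ← pow_add, ← hb, show t + (b - t) = b by omega]
        have h6 : (m : ℝ) * i j + (p : ℝ) ^ j * i' r < m * i t + (p : ℝ) ^ t * i' (b - t) := by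
          have h7 : (p : ℝ) ^ j * (p : ℝ) ^ r * x = (p : ℝ) ^ t * (p : ℝ) ^ (b - t) * x := by rw [h5]
          linarith
        have h8 : m * i j + p ^ j * i' r < m * i t + p ^ t * i' (b - t) := by exact_mod_cast h6
        rw [hq]
        linarith
    · refine h.pow_dvd_coeff le_rfl (hE.trans_le ?_)
      have h1 : (z - m * i t) / 2 ≤ powWeight p e (minWeight p i' x) t b := by
        refine le_powWeight hp.one_le _ _ _ fun t' ht' hb' => ?_
        have h2 := hz₂ t' hb'
        have h3 : (m : ℝ) * i t' ≤ m * i t + (t - t' : ℕ) * e := by exact_mod_cast hie t t' ht'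
        have h4 : (0 : ℝ) ≤ (t - t' : ℕ) * e := by positivity
        linarith
      have h2 := powWeight_nonneg (e := e) hp.one_le hθ t b
      have h3 : (2 : ℝ) ≤ q := by exact_mod_cast hq2
      have h4 := mul_le_mul_of_nonneg_right h3 h2
      push_cast
      linarith
  rw [finsetSum_coeff, ← add_sum_erase _ _ (mem_Ico.2 ⟨Nat.one_le_pow _ _ hp.pos, hK⟩),
    dvd_add_left (dvd_sum fun k hk => hother k (mem_Ico.1 (mem_erase.1 hk).2).1 (mem_erase.1 hk).1),
    coeff_C_mul]
  intro hdvd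
  have h1 := dvd_coeff_pow_prime_pow_sub hx he hθ (minWeight_antitone p i' x) hw0 hwt
    r j (z - m * i j) fun t' ht' => by
      have h2 := hz₂ t' (by omega)
      have h3 : (m : ℝ) * i t' ≤ m * i j + (j - t' : ℕ) * e := by
        exact_mod_cast hie j t' ht'.le
      rw [show r + j = b by omega]
      linarith
  rw [show r + j = b by omega] at h1
  have hdj' := hd (p ^ j) (Nat.one_le_pow _ _ hp.pos)
  rw [padicValNat.prime_pow] at hdj'
  have hwr' := hw (p ^ r) (Nat.one_le_pow _ _ hp.pos)
  rw [padicValNat.prime_pow] at hwr'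
  rw [← sub_add_cancel ((w ^ p ^ j).coeff (p ^ b)) (w.coeff (p ^ r) ^ p ^ j), mul_add] at hdvd
  have h2 : π ^ (D + m * i j + p ^ j * i' r + 1) ∣ d (p ^ j) * w.coeff (p ^ r) ^ p ^ j := by
    refine (dvd_add_right ?_).1 hdvd
    refine dvd_trans ?_ (mul_dvd_mul hdj' h1)
    rw [← pow_add]
    refine pow_dvd_pow π ?_
    have h4 := Nat.le_ceil (z - m * i j - (p ^ b : ℕ) * x)
    have h5 : ((D + m * i j + p ^ j * i' r + 1 : ℕ) : ℝ) <
        (D + m * i j + ⌈z - m * i j - (p ^ b : ℕ) * x⌉₊ : ℕ) + 1 := by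
      refine hE.trans_le ?_
      push_cast at h4 ⊢
      linarith
    have h6 : D + m * i j + p ^ j * i' r + 1 <
        D + m * i j + ⌈z - m * i j - (p ^ b : ℕ) * x⌉₊ + 1 := by exact_mod_cast h5
    exact Nat.lt_succ_iff.1 h6
  rcases succ_dvd_or_succ_dvd_of_succ_sum_dvd_mul hπ hdj'
    (by rw [mul_comm, pow_mul]; exact pow_dvd_pow_of_dvd hwr' _) h2 with h3 | h3
  · exact hdj h3
  · obtain ⟨v, hv⟩ := hwr'
    rw [hv, mul_pow, ← pow_mul, mul_comm (i' r), pow_succ,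
      mul_dvd_mul_iff_left (pow_ne_zero _ hπ.ne_zero)] at h3
    apply hwr
    rw [hv, pow_succ]
    exact mul_dvd_mul_left _ (hπ.dvd_of_dvd_pow h3)

end Composition

/-! ### Perturbing the weight of the variable -/

section Weight

variable {i i' : ℕ → ℕ} {ν μ m p : ℕ} {x lam : ℝ}

/-- A dominant pair stays dominant, in the stronger sense needed to compute a coefficient of a
composition, for some weight of the variable. -/
theorem exists_weight (hx : 0 ≤ x) (hp : 1 < p)
    (hanti' : Antitone i') {j r : ℕ}
    (hlam : ∀ t s, t + s ≤ j + r → pairVal p m i i' x j r ≤ pairVal p m i i' x t s)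
    (hstrict : ∀ r' < r, i' r < i' r')
    (hdom : ∀ t ≤ j + r, t ≠ j → pairVal p m i i' x j r < pairVal p m i i' x t (j + r - t)) :
    ∃ x' : ℝ, 0 ≤ x' ∧
      (∀ t ≤ j + r, t ≠ j → pairVal p m i i' x' j r < pairVal p m i i' x' t (j + r - t)) ∧
      ∀ t ≤ j + r, pairVal p m i i' x' j r <
        m * i t + 2 * ((p : ℝ) ^ t * minWeight p i' x' (j + r - t)) := by
  have hp0 : (0 : ℝ) < p := by exact_mod_cast hp.le
  have hp1 : (1 : ℝ) ≤ p := by exact_mod_cast hp.le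
  rcases hx.lt_or_eq with hx | rfl
  · refine ⟨x, hx.le, hdom, fun t ht => ?_⟩
    obtain ⟨s, hs, hs'⟩ := exists_minWeight_eq p i' x (j + r - t)
    refine (hlam t s (by omega)).trans_lt ?_
    rw [hs', pairVal]
    have : 0 < (p : ℝ) ^ t * (i' s + (p : ℝ) ^ s * x) := by positivity
    linarith
  · have hsplit : ∀ ε t s, pairVal p m i i' ε t s = (m * i t + p ^ t * i' s : ℕ) +
        (p : ℝ) ^ (t + s) * ε := fun ε t s => by
      rw [pairVal, pow_add]
      push_cast
      ring
    simp only [hsplit, mul_zero, add_zero, Nat.cast_lt] at hdom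
    -- At `x = 0` doubling gains nothing when the minimal weight is zero. All values are then
    -- integers, so strict inequalities have margin `1`, and this `ε` raises the value of every pair
    -- on level `j + r` by exactly `1 / 2`.
    set ε : ℝ := 1 / (2 * (p : ℝ) ^ (j + r)) with hε
    have hε0 : 0 < ε := by positivity
    have hε1 : (p : ℝ) ^ (j + r) * ε = 1 / 2 := by rw [hε]; field_simp
    refine ⟨ε, hε0.le, fun t ht hne => ?_, fun t ht => ?_⟩
    · rw [hsplit, hsplit, show t + (j + r - t) = j + r by omega]
      have := hdom t ht hne
      gcongr
    · obtain ⟨s, hs, hs'⟩ := exists_minWeight_eq p i' ε (j + r - t)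
      rw [hs', hsplit, hε1]
      have h0 : 0 < (p : ℝ) ^ t * ((p : ℝ) ^ s * ε) := by positivity
      by_cases htj : t = j
      · subst htj
        rcases (show s ≤ r by omega).lt_or_eq with hsr | rfl
        · have h1 : ((i' r : ℝ)) + 1 ≤ i' s := by exact_mod_cast hstrict s hsr
          have h2 : (1 : ℝ) ≤ (p : ℝ) ^ t := one_le_pow₀ hp1
          have h3 : (p : ℝ) ^ t * (i' r + 1) ≤ (p : ℝ) ^ t * i' s := by gcongr
          have h4 : 0 ≤ (p : ℝ) ^ t * i' s := by positivity
          push_cast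
          linarith
        · have h4 : 0 ≤ (p : ℝ) ^ t * i' s := by positivity
          rw [pow_add, mul_assoc] at hε1
          push_cast
          linarith
      · have h1 : ((m * i j + p ^ j * i' r : ℕ) : ℝ) + 1 ≤
            (m * i t + p ^ t * i' (j + r - t) : ℕ) := by exact_mod_cast hdom t ht htj
        have h2 : (p : ℝ) ^ t * i' (j + r - t) ≤ (p : ℝ) ^ t * i' s := by
          have := hanti' hs
          gcongr
        have h4 : 0 ≤ (p : ℝ) ^ t * i' s := by positivity
        push_cast at h1 ⊢
        linarith

end Weight

/-! ### Comparison of `lam` with the values at pairs -/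

section Lambda

variable {A B C : Type*} [CommRing A] [CommRing B] [CommRing C] [Algebra A B] [Algebra B C]
  {p n m : ℕ} {πK : A} {πL πL' : B} {πM : C} {x : ℝ}

theorem mul_phiTilde_eq_pairVal (hm : m ≠ 0) (j k : ℕ) :
    m * phiTilde p n πK πL j (phiTilde p m πL' πM k x / m) =
      pairVal p m (idx p n πK πL) (idx p m πL' πM) x j k := by
  have : (m : ℝ) ≠ 0 := by exact_mod_cast hm
  rw [phiTilde, phiTilde, pairVal, idx, idx]
  field_simp

/-- Enlarging `j` and `k` to a pair on level `l` only enlarges the ranges of the inner minima, so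
`lam` bounds the values on all levels up to `l`. -/
theorem lam_le_pairVal (hm : m ≠ 0) {l : ℕ} (hl : l ≤ padicValNat p n + padicValNat p m) {j k : ℕ}
    (hj : j ≤ padicValNat p n) (hk : k ≤ padicValNat p m) (hjk : j + k ≤ l) :
    lam p n m πK πL πL' πM l hl x ≤
      pairVal p m (idx p n πK πL) (idx p m πL' πM) x j k := by
  obtain ⟨j₁, k₁, hj₁, hk₁, hjj, hkk, hs⟩ : ∃ j₁ k₁, j₁ ≤ padicValNat p n ∧ k₁ ≤ padicValNat p m ∧
      j ≤ j₁ ∧ k ≤ k₁ ∧ j₁ + k₁ = l :=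
    ⟨min (padicValNat p n) (l - k), l - min (padicValNat p n) (l - k), by omega, by omega,
      by omega, by omega, by omega⟩
  have hmem : (j₁, k₁) ∈ Omega (padicValNat p n) (padicValNat p m) l := by
    simp only [Omega, mem_filter, mem_product, mem_range]
    omega
  rw [← mul_phiTilde_eq_pairVal hm]
  refine (inf'_le _ hmem).trans ?_
  have h1 : phi p m πL' πM k₁ x ≤ phiTilde p m πL' πM k x :=
    inf'_le _ (mem_range.2 (Nat.lt_succ_of_le hkk))
  have h2 : phi p n πK πL j₁ (phi p m πL' πM k₁ x / m) ≤
      phiTilde p n πK πL j (phi p m πL' πM k₁ x / m) :=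
    inf'_le _ (mem_range.2 (Nat.lt_succ_of_le hjj))
  refine mul_le_mul_of_nonneg_left (h2.trans ?_) (Nat.cast_nonneg m)
  rw [phiTilde, phiTilde]
  gcongr

end Lambda

/-! ### The composite extension -/

section Tower

theorem TotRam.not_isUnit_natCast {A B : Type*} [CommRing A] [IsDomain A]
    [IsDiscreteValuationRing A] [CommRing B] [IsDomain B] [IsDiscreteValuationRing B] [Algebra A B]
    {p n : ℕ} (h : TotRam A B n) (hp : ¬ IsUnit (p : A)) :
    ¬ IsUnit (p : B) := by
  rwa [← map_natCast (algebraMap A B), h.isUnit_algebraMap_iff]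

/-- The ramification index of `p` may be replaced by a natural number in the relations between
the indices of inseparability. -/
theorem exists_absolute_index {p n : ℕ} {A B : Type*} [CommRing A] [CommRing B] [Algebra A B] {πA : A}
    {πB : B} (h0 : coeffs p n πA πB 0 ≠ 0) (hfin : index p n πA πB 0 ≠ ⊤) :
    ∃ e, πB ^ e ∣ (p : B) ∧
      ∀ t t', t' ≤ t → idx p n πA πB t' ≤ idx p n πA πB t + (t - t') * e := by
  rcases eq_or_ne (emultiplicity πB (p : B)) ⊤ with htop | htop
  -- Here `p = 0` in the discrete valuation rings of interest; infinite multiplicity allows any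
  -- exponent, and the largest index makes the inequality immediate for `t' < t`.
  · refine ⟨idx p n πA πB 0, ?_, fun t t' ht => ?_⟩
    · rw [pow_dvd_iff_le_emultiplicity, htop]
      exact le_top
    · rcases ht.lt_or_eq with ht | rfl
      · have h1 := idx_antitone h0 hfin (Nat.zero_le t')
        have h2 := Nat.le_mul_of_pos_left (idx p n πA πB 0) (Nat.sub_pos_of_lt ht)
        omega
      · simp
  · obtain ⟨e, he⟩ := ENat.ne_top_iff_exists.1 htop
    refine ⟨e, ?_, fun t t' ht => ?_⟩
    · rw [pow_dvd_iff_le_emultiplicity, he]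
    · have := idx_le_add h0 hfin ht
      rw [← he] at this
      exact_mod_cast this

variable {p : ℕ} [Fact p.Prime]
  {A B C : Type*} [CommRing A] [IsDomain A] [IsDiscreteValuationRing A]
  [CommRing B] [IsDomain B] [IsDiscreteValuationRing B]
  [CommRing C] [IsDomain C] [IsDiscreteValuationRing C]
  [Algebra A B] [Algebra B C] [Algebra A C] [IsScalarTower A B C] {n m : ℕ}

theorem TotRam.pow_dvd_of_pow_dvd_algebraMap (h : TotRam A B n) {a : A} {b : B}
    (ha : Irreducible a) (hb : Irreducible b) {c : A} {k : ℕ}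
    (hc : b ^ (n * k + 1) ∣ algebraMap A B c) : a ^ (k + 1) ∣ c := by
  rcases eq_or_ne c 0 with rfl | h0
  · exact dvd_zero _
  obtain ⟨r, u, rfl⟩ := IsDiscreteValuationRing.eq_unit_mul_pow_irreducible h0 ha
  rw [map_mul, map_pow, (u.isUnit.map (algebraMap A B)).dvd_mul_left] at hc
  have h1 := hc.trans ((h.assoc ha hb).pow_pow (n := r)).dvd
  rw [← pow_mul, pow_dvd_pow_iff hb.ne_zero hb.not_isUnit] at h1
  exact (pow_dvd_pow a (Nat.lt_of_mul_lt_mul_left (a := n) (by omega))).mul_left _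

theorem TotRam.pow_dvd_algebraMap (h : TotRam A B n) {a : A} {b : B}
    (ha : Irreducible a) (hb : Irreducible b) {c : A} {k : ℕ}
    (hc : a ^ k ∣ c) : b ^ (n * k) ∣ algebraMap A B c := by
  have h1 := ((h.assoc ha hb).pow_pow (n := k)).symm.dvd
  rw [← pow_mul] at h1
  refine h1.trans ?_
  rw [← map_pow]
  exact map_dvd _ hc

/-- The polynomials attached to a tower: `H` is the composite of polynomials for the two steps. -/
theorem TotRam.exists_composition (h₁ : TotRam A B n) (h₂ : TotRam B C m)
    (h₃ : TotRam A C (n * m))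
    (hT : ∀ a : A, ∃ t ∈ teichmullerReps p A, ¬ IsUnit (a - t)) (hp : ¬ IsUnit (p : A))
    {πK : A} {πL : B} {πM : C} (hK : Irreducible πK) (hL : Irreducible πL) (hM : Irreducible πM) :
    ∃ (H : A[X]) (w : C[X]) (d : ℕ → C), aeval πM H = algebraMap A C πK ∧
      IsUnit (H.coeff (n * m)) ∧ w.coeff 0 = 0 ∧
      (∀ k, 1 ≤ k → πM ^ idx p m πL πM (padicValNat p k) ∣ w.coeff k) ∧
      (∀ r ≤ padicValNat p m, (∀ r' < r, idx p m πL πM r < idx p m πL πM r') →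
        ¬ πM ^ (idx p m πL πM r + 1) ∣ w.coeff (p ^ r)) ∧
      (∀ k, 1 ≤ k → πM ^ (n * m + m * idx p n πK πL (padicValNat p k)) ∣ d k) ∧
      (∀ j ≤ padicValNat p n, (∀ j' < j, idx p n πK πL j < idx p n πK πL j') →
        ¬ πM ^ (n * m + m * idx p n πK πL j + 1) ∣ d (p ^ j)) ∧
      ∃ N, ∀ K, N ≤ K → ∀ k, 1 ≤ k → (shift πM (H.map (algebraMap A C))).coeff k =
        (∑ k ∈ Ico 1 K, Polynomial.C (d k) * w ^ k).coeff k := by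
  have hpB := h₁.not_isUnit_natCast hp
  have hpC := h₂.not_isUnit_natCast hpB
  have hTB : ∀ b : B, ∃ t ∈ teichmullerReps p B, ¬ IsUnit (b - t) := fun b => by
    obtain ⟨t, ht, htb⟩ := h₁.exists_teichmullerReps_sub hT hL b
    exact ⟨_, map_mem_teichmullerReps _ ht, (dvd_iff_not_isUnit hL _).1 htb⟩
  obtain ⟨F, hF, hFlow, hFu, hFd, hFs⟩ := h₁.exists_good_polynomial h₁ hT hpB hK hL
    (h₁.index_zero_ne_top hT hpB hK hL)
  -- `G` is taken over `A` rather than `B`, so that `F.comp G` lies in `A[X]` and is admissible for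
  -- the whole tower.
  obtain ⟨G, hG, hGlow, hGu, hGd, hGs⟩ := h₃.exists_good_polynomial h₂ hT hpC hL hM
    (h₂.index_zero_ne_top hTB hpC hL hM)
  obtain ⟨u, hu⟩ := (h₂.assoc hL hM).symm
  have hϖ : algebraMap B C πL ≠ 0 := by
    rw [← hu]
    exact mul_ne_zero (pow_ne_zero _ hM.ne_zero) u.ne_zero
  obtain ⟨w, hw⟩ : Polynomial.C (algebraMap B C πL) ∣
      shift πM (G.map (algebraMap A C)) - Polynomial.C (algebraMap B C πL) := by
    rw [C_dvd_iff_dvd_coeff]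
    intro k
    rw [coeff_sub]
    rcases Nat.eq_zero_or_pos k with rfl | hk
    · rw [coeff_shift_zero, eval_map_algebraMap, hG, coeff_C_zero, sub_self]
      exact dvd_zero _
    · rw [coeff_C_of_ne_zero hk.ne', sub_zero]
      exact (h₂.assoc hL hM).dvd.trans ((pow_dvd_pow _ (Nat.le_add_right _ _)).trans (hGd k hk))
  have hw' : shift πM (G.map (algebraMap A C)) = Polynomial.C (algebraMap B C πL) * (1 + w) := by
    linear_combination hw
  have hwk : ∀ k, 1 ≤ k → (shift πM (G.map (algebraMap A C))).coeff k =
      πM ^ m * (u * w.coeff k) := by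
    intro k hk
    rw [hw', coeff_C_mul, coeff_add, coeff_one, if_neg (by omega), zero_add, ← hu, mul_assoc]
  have hdvd : ∀ k a, 1 ≤ k → (πM ^ (m + a) ∣ (shift πM (G.map (algebraMap A C))).coeff k ↔
      πM ^ a ∣ w.coeff k) := by
    intro k a hk
    rw [hwk k hk, pow_add, mul_dvd_mul_iff_left (pow_ne_zero _ hM.ne_zero),
      u.isUnit.dvd_mul_left]
  have hpp : p.Prime := Fact.out
  have hshift : shift (algebraMap B C πL) (F.map (algebraMap A C)) =
      (shift πL (F.map (algebraMap A B))).map (algebraMap B C) := by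
    rw [shift, shift, Polynomial.map_comp, Polynomial.map_map, ← IsScalarTower.algebraMap_eq]
    simp
  refine ⟨F.comp G, w, fun k => algebraMap B C ((shift πL (F.map (algebraMap A B))).coeff k),
    ?_, isUnit_coeff_comp h₂.pos hFlow hFu hGlow hGu, ?_, fun k hk => ?_, fun r hr hs => ?_,
    fun k hk => ?_, fun j hj hs => ?_, ?_⟩
  · rw [aeval_comp, hG, aeval_algebraMap_apply, hF, ← IsScalarTower.algebraMap_apply]
  · have := congrArg (fun P => coeff P 0) hw
    simp only [coeff_sub, coeff_shift_zero, eval_map_algebraMap, hG, coeff_C_zero, sub_self,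
      coeff_C_mul] at this
    exact (mul_eq_zero.1 this.symm).resolve_left hϖ
  · exact (hdvd k _ hk).1 (hGd k hk)
  · rw [← hdvd _ _ (Nat.one_le_pow _ _ hpp.pos)]
    exact hGs r hr hs
  · have := h₂.pow_dvd_algebraMap hL hM (hFd k hk)
    rwa [mul_add, mul_comm m n] at this
  · intro hcon
    rw [mul_comm n m, ← mul_add] at hcon
    exact hFs j hj hs (h₂.pow_dvd_of_pow_dvd_algebraMap hL hM hcon)
  · refine ⟨((shift πL (F.map (algebraMap A B))).map (algebraMap B C)).natDegree + 1,
      fun K hK k hk => ?_⟩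
    have h4 := comp_sub_C_eq_sum ((shift πL (F.map (algebraMap A B))).map (algebraMap B C)) w
      (N := K) (by omega)
    simp only [coeff_map] at h4
    rw [← h4, coeff_sub, coeff_C_of_ne_zero (by omega), sub_zero, Polynomial.map_comp,
      shift_comp hw', hshift]

theorem TotRam.phi_tower (h₁ : TotRam A B n) (h₂ : TotRam B C m) (h₃ : TotRam A C (n * m))
    (hT : ∀ a : A, ∃ t ∈ teichmullerReps p A, ¬ IsUnit (a - t)) (hp : ¬ IsUnit (p : A))
    {πK πK' : A} {πL πL' : B} {πM πM' : C} (hK : Irreducible πK) (hK' : Irreducible πK')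
    (hL : Irreducible πL) (hL' : Irreducible πL') (hM : Irreducible πM) (hM' : Irreducible πM')
    (l : ℕ) (hl : l ≤ padicValNat p n + padicValNat p m) (x : ℝ) (hx : 0 ≤ x) :
    lam p n m πK πL πL' πM l hl x ≤ phi p (n * m) πK' πM' l x ∧
      ((∃ l₀ ≤ l, (minPairs p n m πK πL πL' πM l hl l₀ x).card = 1) →
        phi p (n * m) πK' πM' l x = lam p n m πK πL πL' πM l hl x) := by
  have hpp : p.Prime := Fact.out
  have hpB := h₁.not_isUnit_natCast hp
  have hpC := h₂.not_isUnit_natCast hpB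
  have hTB : ∀ b : B, ∃ t ∈ teichmullerReps p B, ¬ IsUnit (b - t) := fun b => by
    obtain ⟨t, ht, htb⟩ := h₁.exists_teichmullerReps_sub hT hL b
    exact ⟨_, map_mem_teichmullerReps _ ht, (dvd_iff_not_isUnit hL _).1 htb⟩
  obtain ⟨H, w, d, hH, hHu, hw0, hw, hws, hd, hds, N, hN⟩ :=
    h₁.exists_composition h₂ h₃ hT hp hK hL' hM
  -- The two polynomials had to be composed through the same uniformizer `πL'`; independence of the
  -- indices returns to `πL`.
  rw [← h₁.idx_eq hT hpB hK hL hK hL'] at hd hds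
  have h0 := h₁.coeffs_zero_ne_zero h₁ hT hK hL
  have hfin := h₁.index_zero_ne_top hT hpB hK hL
  have h0' := h₂.coeffs_zero_ne_zero h₂ hTB hL' hM
  have hfin' := h₂.index_zero_ne_top hTB hpC hL' hM
  have hi := fun j => idx_eq_zero_iff h0 hfin (j := j)
    (emultiplicity_ne_zero.2 ((dvd_iff_not_isUnit hL _).2 hpB))
  have hi' := fun j => idx_eq_zero_iff h0' hfin' (j := j)
    (emultiplicity_ne_zero.2 ((dvd_iff_not_isUnit hM _).2 hpC))
  have hanti := idx_antitone h0 hfin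
  have hanti' := idx_antitone h0' hfin'
  obtain ⟨e, he, hie⟩ := exists_absolute_index h0 hfin
  have he' : πM ^ (m * e) ∣ (p : C) := by
    simpa using h₂.pow_dvd_algebraMap hL hM he
  have hie' : ∀ t t', t' ≤ t →
      m * idx p n πK πL t' ≤ m * idx p n πK πL t + (t - t') * (m * e) := fun t t' ht => by
    have := Nat.mul_le_mul_left m (hie t t' ht)
    rw [mul_add] at this
    rwa [mul_left_comm (t - t')]
  have hνμ : padicValNat p (n * m) = padicValNat p n + padicValNat p m :=
    padicValNat.mul h₁.pos.ne' h₂.pos.ne'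
  have hlow : ∀ i < n * m, ¬ IsUnit (H.coeff i) := fun i hi =>
    h₃.not_isUnit_coeff hM (by rw [hH]; exact (h₃.assoc hK hM).symm.dvd) hi
  have hiff := fun {j : ℕ} (hj : j ≤ padicValNat p (n * m)) (y : ℕ) =>
    h₃.le_idx_iff hT hpC hK' hM' hM hH hlow hHu hj y
  set Λ := lam p n m πK πL πL' πM l hl x with hΛ
  have hlamle : ∀ j ≤ padicValNat p n, ∀ k ≤ padicValNat p m, j + k ≤ l →
      Λ ≤ pairVal p m (idx p n πK πL) (idx p m πL' πM) x j k := fun j hj k hk hjk =>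
    lam_le_pairVal h₂.pos.ne' hl hj hk hjk
  have hlamle' : ∀ j k, j + k ≤ l →
      Λ ≤ pairVal p m (idx p n πK πL) (idx p m πL' πM) x j k := fun j k hjk =>
    le_pairVal hx hpp.one_lt (fun j => (hi j).2) (fun j => (hi' j).2) hlamle hjk
  have hlower : Λ ≤ phi p (n * m) πK' πM' l x := by
    refine le_inf' _ _ fun l' hl' => ?_
    have hl'l : l' ≤ l := Nat.lt_succ_iff.1 (mem_range.1 hl')
    change Λ ≤ (idx p (n * m) πK' πM' l' : ℝ) + (p : ℝ) ^ l' * x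
    rcases le_or_gt (Λ - (p : ℝ) ^ l' * x) 0 with hneg | hpos
    · have : (0 : ℝ) ≤ idx p (n * m) πK' πM' l' := Nat.cast_nonneg _
      linarith
    · have hwt := weightGE_composition (π := πM) (D := n * m) hx he' hw0 hw hd hie'
        (fun j k hjk => hlamle' j k (hjk.trans hl'l)) N
      have h4 : ⌈Λ - (p : ℝ) ^ l' * x⌉₊ ≤ idx p (n * m) πK' πM' l' := by
        rw [hiff (by omega)]
        intro k hk1 hk
        rw [hN N le_rfl k hk1]
        refine hwt.pow_dvd_coeff hk ?_
        have h5 := Nat.ceil_lt_add_one hpos.le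
        have h6 : (k : ℝ) * x ≤ (p : ℝ) ^ l' * x := by
          gcongr
          exact_mod_cast hk
        push_cast at h5 ⊢
        linarith
      have h5 := Nat.le_ceil (Λ - (p : ℝ) ^ l' * x)
      have h6 : ((⌈Λ - (p : ℝ) ^ l' * x⌉₊ : ℕ) : ℝ) ≤ idx p (n * m) πK' πM' l' := by
        exact_mod_cast h4
      linarith
  refine ⟨hlower, fun hex => le_antisymm ?_ hlower⟩
  obtain ⟨l₀, hl₀, hcard⟩ := hex
  obtain ⟨⟨j₀, k₀⟩, hjk⟩ := card_eq_one.1 hcard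
  have hmem : ∀ j k, (j, k) ∈ minPairs p n m πK πL πL' πM l hl l₀ x ↔
      (j ≤ padicValNat p n ∧ k ≤ padicValNat p m ∧ j + k = l₀) ∧
        pairVal p m (idx p n πK πL) (idx p m πL' πM) x j k = Λ := by
    intro j k
    rw [minPairs, mem_filter, mul_phiTilde_eq_pairVal h₂.pos.ne', Omega]
    simp only [mem_filter, mem_product, mem_range, Nat.lt_succ_iff, and_assoc]
    exact Iff.rfl
  obtain ⟨⟨hj₀, hk₀, hs₀⟩, hv₀⟩ := (hmem j₀ k₀).1 (by rw [hjk]; exact mem_singleton_self _)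
  obtain ⟨j, k, hj, hk, hjkl, hval, hsj, hsk, hdom⟩ := exists_strict_pair hx hpp.one_lt h₂.pos
    hanti hanti' hi hi' hlamle ⟨j₀, k₀, hj₀, hk₀, by omega, hv₀, fun s hs r hr hsr hv => by
      have : (s, r) ∈ minPairs p n m πK πL πL' πM l hl l₀ x :=
        (hmem s r).2 ⟨⟨hs, hr, by omega⟩, hv⟩
      rw [hjk, mem_singleton, Prod.mk.injEq] at this
      exact this.1⟩
  rw [← hval] at hdom
  -- The weight `x'` serves only to isolate a coefficient, whose valuation does not involve it; the
  -- given `x` returns in the last estimate.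
  obtain ⟨x', hx', hdom₁, hdom₂⟩ := exists_weight hx hpp.one_lt hanti'
    (fun t s hts => by rw [hval]; exact hlamle' t s (hts.trans hjkl)) hsk hdom
  have hnot := not_pow_dvd_coeff_composition hM.prime hx' he' hw0 hw hd hie' (hds j hj hsj)
    (hws k hk hsk) hdom₁ hdom₂ (K := N + p ^ j + 1) (by omega)
  rw [← hN _ (by omega) _ (Nat.one_le_pow _ _ hpp.pos)] at hnot
  have hle : idx p (n * m) πK' πM' (j + k) ≤
      m * idx p n πK πL j + p ^ j * idx p m πL' πM k := by
    by_contra! hlt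
    refine hnot ?_
    rw [show n * m + m * idx p n πK πL j + p ^ j * idx p m πL' πM k + 1 =
      n * m + (m * idx p n πK πL j + p ^ j * idx p m πL' πM k + 1) by ring]
    exact (hiff (by omega) _).1 hlt _ (Nat.one_le_pow _ _ hpp.pos) le_rfl
  have hle' : (idx p (n * m) πK' πM' (j + k) : ℝ) ≤
      m * idx p n πK πL j + (p : ℝ) ^ j * idx p m πL' πM k := by exact_mod_cast hle
  refine (inf'_le _ (mem_range.2 (Nat.lt_succ_of_le hjkl))).trans ?_
  change (idx p (n * m) πK' πM' (j + k) : ℝ) + (p : ℝ) ^ (j + k) * x ≤ Λ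
  rw [← hval, pairVal, pow_add]
  linarith

end Tower

/-! ### From field extensions to their rings of integers -/

section Fields

theorem aeval_derivative_minpoly_ne_zero (A K L B : Type*) [CommRing A] [IsDomain A]
    [IsIntegrallyClosed A] [Field K] [Algebra A K] [IsFractionRing A K] [Field L] [Algebra K L]
    [Algebra.IsSeparable K L] [CommRing B] [IsDomain B] [Algebra A B] [Algebra B L] [Algebra A L]
    [IsScalarTower A B L] [IsScalarTower A K L]
    {b : B} (hb : IsIntegral A b) : aeval b (derivative (minpoly A b)) ≠ 0 := by
  intro h
  have h1 := minpoly.isIntegrallyClosed_eq_field_fractions K L hb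
  have h2 := (Algebra.IsSeparable.isSeparable K (algebraMap B L b)).aeval_derivative_ne_zero
    (minpoly.aeval K (algebraMap B L b))
  rw [h1, derivative_map, aeval_map_algebraMap, aeval_algebraMap_apply, h, map_zero] at h2
  exact h2 rfl

/-- The ring of integers of a totally ramified extension. -/
theorem exists_totRam (A K L B : Type*) [CommRing A] [IsDomain A] [IsDiscreteValuationRing A]
    [Field K] [Algebra A K] [IsFractionRing A K] [Field L] [Algebra K L] [FiniteDimensional K L]
    [Algebra.IsSeparable K L] [CommRing B] [Algebra A B] [Algebra B L] [Algebra A L]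
    [IsScalarTower A B L] [IsScalarTower A K L] [IsIntegralClosure B A L]
    (h : IsTotallyRamified A B (Module.finrank K L)) :
    ∃ (_ : IsDomain B) (_ : IsDiscreteValuationRing B) (_ : IsFractionRing B L),
      TotRam A B (Module.finrank K L) := by
  have hinj : Function.Injective (algebraMap B L) := IsIntegralClosure.algebraMap_injective B A L
  have hdom : IsDomain B := hinj.isDomain (algebraMap B L)
  have hded : IsDedekindDomain B := IsIntegralClosure.isDedekindDomain A K L B
  have hfrac : IsFractionRing B L := IsIntegralClosure.isFractionRing_of_finite_extension A K L B
  have hfin : Module.Finite A B := IsIntegralClosure.finite A K L B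
  have hint : Algebra.IsIntegral A B := IsIntegralClosure.isIntegral_algebra A L
  have hALinj : Function.Injective (algebraMap A L) := by
    rw [IsScalarTower.algebraMap_eq A K L]
    exact (algebraMap K L).injective.comp (IsFractionRing.injective A K)
  have hAB : Function.Injective (algebraMap A B) := by
    rw [IsScalarTower.algebraMap_eq A B L] at hALinj
    exact Function.Injective.of_comp hALinj
  have hfA : FaithfulSMul A L := (faithfulSMul_iff_algebraMap_injective A L).2 hALinj
  have hfB : FaithfulSMul A B := (faithfulSMul_iff_algebraMap_injective A B).2 hAB
  have hfree : Module.Free A B := IsIntegralClosure.module_free A K L B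
  have hrank : Module.finrank A B = Module.finrank K L := IsIntegralClosure.rank A K L B
  set q := IsLocalRing.maximalIdeal A with hq
  obtain ⟨P, hP, hPq, hPe⟩ := h q inferInstance
  have hq0 : q ≠ ⊥ := IsDiscreteValuationRing.not_a_field A
  have hP0 : P ≠ ⊥ := Ideal.ne_bot_of_liesOver_of_ne_bot hq0 P
  have hPmax : P.IsMaximal := hP.isMaximal hP0
  have hnpos : 0 < Module.finrank K L := Module.finrank_pos
  have := Fintype.ofFinite (q.primesOver B)
  -- In `∑ e f = [L : K]` the prime `P` with `e = [L : K]` exhausts the sum, so `f = 1` and there is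
  -- no other prime over `q`; hence `B` is local with the same residue field.
  have hsum := Ideal.sum_ramification_inertia_eq_finrank q B
  rw [hrank] at hsum
  have hterm : ∀ Q : q.primesOver B, 0 < Q.1.ramificationIdx A * Q.1.inertiaDeg A := fun Q => by
    have := Q.2.1
    exact Nat.mul_pos (Ideal.ramificationIdx_pos Q.1 A) (Ideal.inertiaDeg_pos Q.1 A)
  have hPf : 0 < P.inertiaDeg A := Ideal.inertiaDeg_pos P A
  set P' : q.primesOver B := ⟨P, hP, hPq⟩ with hP'
  rw [← add_sum_erase _ _ (mem_univ P')] at hsum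
  change P.ramificationIdx A * P.inertiaDeg A + _ = _ at hsum
  rw [hPe] at hsum
  have hle : Module.finrank K L ≤ Module.finrank K L * P.inertiaDeg A :=
    Nat.le_mul_of_pos_right _ hPf
  have hf1 : P.inertiaDeg A = 1 :=
    Nat.eq_of_mul_eq_mul_left hnpos (by omega)
  have huniq : ∀ Q : q.primesOver B, Q = P' := by
    intro Q
    by_contra hne
    have h1 := single_le_sum (f := fun Q : q.primesOver B =>
      Q.1.ramificationIdx A * Q.1.inertiaDeg A) (fun _ _ => Nat.zero_le _)
      (mem_erase.2 ⟨hne, mem_univ Q⟩)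
    have h2 := hterm Q
    omega
  have hlocal : IsLocalRing B := by
    refine IsLocalRing.of_unique_max_ideal ⟨P, hPmax, fun Q hQ => ?_⟩
    have hQ' : (Q.under A).IsMaximal := Ideal.isMaximal_comap_of_isIntegral_of_isMaximal Q
    have : Q ∈ q.primesOver B := ⟨hQ.isPrime, ⟨(IsLocalRing.eq_maximalIdeal hQ').symm⟩⟩
    exact congrArg Subtype.val (huniq ⟨Q, this⟩)
  have hPm : P = IsLocalRing.maximalIdeal B := IsLocalRing.eq_maximalIdeal hPmax
  have hnf : ¬ IsField B := fun hB => hP0 (by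
    rw [hPm]
    exact IsLocalRing.isField_iff_maximalIdeal_eq.1 hB)
  have hdvr : IsDiscreteValuationRing B := ((IsDiscreteValuationRing.TFAE B hnf).out 0 2).2 hded
  refine ⟨hdom, hdvr, hfrac, hnpos, ?_, ?_, hfin, fun b =>
    aeval_derivative_minpoly_ne_zero A K L B (Algebra.IsIntegral.isIntegral b)⟩
  · intro a b ha hb
    have ha0 : algebraMap A B a ≠ 0 := fun h0 =>
      ha.ne_zero (hAB (h0.trans (map_zero _).symm))
    obtain ⟨k, hk⟩ := IsDiscreteValuationRing.associated_pow_irreducible ha0 hb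
    have hmap : q.map (algebraMap A B) = P ^ k := by
      rw [hPm, hq, ha.maximalIdeal_eq, hb.maximalIdeal_eq, Ideal.map_span, Set.image_singleton,
        Ideal.span_singleton_pow, Ideal.span_singleton_eq_span_singleton]
      exact hk
    have h1 : q.ramificationIdx' P = k := by
      refine Ideal.ramificationIdx'_spec hmap.le fun h2 => ?_
      rw [hmap, hPm, hb.maximalIdeal_eq, Ideal.span_singleton_pow, Ideal.span_singleton_pow,
        Ideal.span_singleton_le_span_singleton, pow_dvd_pow_iff hb.ne_zero hb.not_isUnit] at h2
      omega
    rw [Ideal.ramificationIdx'_eq_ramificationIdx q P hq0, hPe] at h1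
    rwa [h1]
  · intro b
    rw [Ideal.inertiaDeg_eq_of_isMaximal q P] at hf1
    let := Ideal.Quotient.field q
    obtain ⟨c, hc⟩ := (finrank_eq_one_iff_of_nonzero' (1 : B ⧸ P) one_ne_zero).1 hf1
      (Ideal.Quotient.mk P b)
    obtain ⟨a, rfl⟩ := Ideal.Quotient.mk_surjective c
    refine ⟨a, ?_⟩
    rw [← mem_nonunits_iff, ← IsLocalRing.mem_maximalIdeal, ← hPm, ← Ideal.Quotient.eq, ← hc,
      Algebra.smul_def, mul_one]
    rfl

end Fields

end GenHH

/-! ### Assembly for the tower of fields -/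

theorem mainTheorem1 (p : ℕ) [Fact p.Prime]
    -- `K` is the fraction field of a complete discrete valuation ring `A`, with perfect residue
    -- field of characteristic `p`
    {A K : Type*} [CommRing A] [IsDomain A] [IsDiscreteValuationRing A]
    [IsAdicComplete (IsLocalRing.maximalIdeal A) A]
    [CharP (IsLocalRing.ResidueField A) p] [PerfectField (IsLocalRing.ResidueField A)]
    [Field K] [Algebra A K] [IsFractionRing A K]
    -- `L/K` is finite separable, with ring of integers `B`
    {L B : Type*} [Field L] [Algebra K L] [FiniteDimensional K L] [Algebra.IsSeparable K L]
    [CommRing B] [Algebra A B] [Algebra B L] [Algebra A L] [IsScalarTower A B L]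
    [IsScalarTower A K L] [IsIntegralClosure B A L]
    -- `M/L` is finite separable, with ring of integers `C`
    {M C : Type*} [Field M] [Algebra L M] [FiniteDimensional L M] [Algebra.IsSeparable L M]
    [CommRing C] [Algebra B C] [Algebra C M] [Algebra B M] [IsScalarTower B C M]
    [IsScalarTower B L M] [IsIntegralClosure C B M]
    -- the composite extension `M/K`
    [Algebra A C] [IsScalarTower A B C] [Algebra K M] [IsScalarTower K L M]
    (hLK : GenHH.IsTotallyRamified A B (Module.finrank K L))
    (hML : GenHH.IsTotallyRamified B C (Module.finrank L M))
    -- arbitrary uniformizers for computing the invariants of `L/K`, of `M/L` and of `M/K`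
    {πK πK' : A} {πL πL' : B} {πM πM' : C}
    (hπK : Irreducible πK) (hπK' : Irreducible πK') (hπL : Irreducible πL)
    (hπL' : Irreducible πL') (hπM : Irreducible πM) (hπM' : Irreducible πM')
    (l : ℕ) (hl : l ≤ padicValNat p (Module.finrank K L) + padicValNat p (Module.finrank L M))
    (x : ℝ) (hx : 0 ≤ x) :
    GenHH.lam p (Module.finrank K L) (Module.finrank L M) πK πL πL' πM l hl x
        ≤ GenHH.phi p (Module.finrank K M) πK' πM' l x ∧
      ((∃ l₀ ≤ l, (GenHH.minPairs p (Module.finrank K L) (Module.finrank L M)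
          πK πL πL' πM l hl l₀ x).card = 1) →
        GenHH.phi p (Module.finrank K M) πK' πM' l x =
          GenHH.lam p (Module.finrank K L) (Module.finrank L M) πK πL πL' πM l hl x) := by
  obtain ⟨_, _, _, h₁⟩ := GenHH.exists_totRam A K L B hLK
  obtain ⟨_, _, _, h₂⟩ := GenHH.exists_totRam B L M C hML
  let : Algebra A M := ((algebraMap K M).comp (algebraMap A K)).toAlgebra
  have : IsScalarTower A K M := IsScalarTower.of_algebraMap_eq fun _ => rfl
  have : IsScalarTower A C M := IsScalarTower.of_algebraMap_eq fun a => by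
    rw [IsScalarTower.algebraMap_apply A B C, ← IsScalarTower.algebraMap_apply B C M,
      IsScalarTower.algebraMap_apply B L M, ← IsScalarTower.algebraMap_apply A B L,
      IsScalarTower.algebraMap_apply A K L, ← IsScalarTower.algebraMap_apply K L M]
    rfl
  have : Algebra.IsSeparable K M := Algebra.IsSeparable.trans K L M
  have hA : Module.Finite A C := by
    have := h₁.finite
    have := h₂.finite
    exact Module.Finite.trans B C
  have h₃ := h₁.trans h₂ fun c => GenHH.aeval_derivative_minpoly_ne_zero A K M C
    (Algebra.IsIntegral.isIntegral c)
  have hp : ¬ IsUnit (p : A) := by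
    rw [← mem_nonunits_iff, ← IsLocalRing.mem_maximalIdeal, ← IsLocalRing.residue_eq_zero_iff,
      map_natCast, CharP.cast_eq_zero]
  rw [← Module.finrank_mul_finrank K L M]
  exact h₁.phi_tower h₂ h₃ GenHH.exists_mem_teichmullerReps hp hπK hπK' hπL hπL' hπM hπM' l hl x hx
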